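/- Let $\mathcal V$ be a finite-dimensional Euclidean Jordan algebra: a finite-dimensional real inner product space with a bilinear product $\circ$ and a unit $u$ such that $x\circ y=y\circ x$, $x^2\circ(x\circ y)=x\circ(x^2\circ y)$ and $\langle x\circ y,z\rangle=\langle x,y\circ z\rangle$. Write $\mathrm{tr}\,x=\langle x,u\rangle$ and assume that the inner product is normalized so that $\mathrm{tr}\,c=1$ for every primitive idempotent $c$. The positive cone is $\mathcal Q_{\mathcal V}=\{x^2 : x\in\mathcal V\}$, and a state is an element $\rho\in\mathcal Q_{\mathcal V}$ with $\mathrm{tr}\,\rho=1$. For $x$ with spectral decomposition $x=\sum_i\lambda_i c_i$ (distinct $\lambda_i$; $c_i$ nonzero orthogonal idempotents with $\sum_i c_i=u$) and $f:\mathbb R\to\mathbb R$ put $f(x)=\sum_i f(\lambda_i)c_i$; the support of $x$ is $\mathrm{supp}\,x=\sum_{\lambda_i\neq 0}c_i$, and for $x\in\mathcal Q_{\mathcal V}$ and real $p\neq0$ the power is $x^p=\sum_{\lambda_i\ne0}\lambda_i^p c_i$. Let $P_x(y)=2\,x\circ(x\circ y)-x^2\circ y$. For states $\rho,\sigma$ and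 $s>0$ the sandwiched Rényi relative entropy is $$\underline D_{1+s}(\rho\|\sigma)=\frac1s\log\mathrm{tr}\Big(P_{\sigma^{-s/(2(1+s))}}(\rho)\Big)^{1+s}$$ if $\mathrm{supp}\,\sigma-\mathrm{supp}\,\rho\in\mathcal Q_{\mathcal V}$ (in particular if all eigenvalues of $\sigma$ are positive), and $\underline D_{1+s}(\rho\|\sigma)=+\infty$ otherwise. A linear map $\kappa:\mathcal V\to\mathcal V$ is called TPCP if $\mathrm{tr}\,\kappa(x)=\mathrm{tr}\,x$ for all $x\in\mathcal V$ and if, for every finite-dimensional Euclidean Jordan algebra $\mathcal V'$, the map $\kappa\otimes\mathrm{id}$ sends the set $\{z\circ z : z\in\mathcal V\otimes\mathcal V'\}$ into itself, where $\mathcal V\otimes\mathcal V'$ carries the bilinear product determined by $(a_1\otimes b_1)\circ(a_2\otimes b_2)=(a_1\circ a_2)\otimes(b_1\circ b_2)$. **Theorem.** For every TPCP map $\kappa:\mathcal V\to\mathcal V$, all states $\rho,\sigma$ in $\mathcal V$ and every real $s>0$, $$\underline D_{1+s}(\rho\|\sigma)\ \ge\ \underline D_{1+s}(\kappa(\rho)\|\kappa(\sigma))$$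 as an inequality in $\mathbb R\cup\{+\infty\}$. -/

import Mathlib

open scoped TensorProduct

noncomputable section

/-- A Euclidean Jordan algebra structure, with unit `one`, on a real inner product space
(finite-dimensionality is a separate type class argument wherever it is needed). The Jordan
product is `jmul`. -/
class EuclideanJordanAlgebra (V : Type*) [NormedAddCommGroup V] [InnerProductSpace ℝ V] where
  jmul : V →ₗ[ℝ] V →ₗ[ℝ] V
  one : V
  one_jmul : ∀ x, jmul one x = x
  jmul_comm : ∀ x y, jmul x y = jmul y x
  jordan : ∀ x y, jmul (jmul x x) (jmul x y) = jmul x (jmul (jmul x x) y)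
  inner_jmul : ∀ x y z, inner ℝ (jmul x y) z = inner ℝ x (jmul y z)

namespace EuclideanJordanAlgebra

/-- The set of squares of a bilinear product. -/
def squares {A : Type*} [AddCommGroup A] [Module ℝ A] (m : A →ₗ[ℝ] A →ₗ[ℝ] A) : Set A :=
  {a | ∃ x, a = m x x}

section Algebra

variable {V : Type*} [NormedAddCommGroup V] [InnerProductSpace ℝ V] [EuclideanJordanAlgebra V]

/-- The positive cone: the set of squares. -/
def positiveCone (V : Type*) [NormedAddCommGroup V] [InnerProductSpace ℝ V]
    [EuclideanJordanAlgebra V] : Set V :=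
  squares (jmul (V := V))

/-- The trace `tr x = ⟨x, u⟩`. -/
def trace (x : V) : ℝ := inner ℝ x (one : V)

/-- A state is a positive element of trace one. -/
def IsState (ρ : V) : Prop := ρ ∈ positiveCone V ∧ trace ρ = 1

def IsIdempotent (c : V) : Prop := jmul c c = c

/-- A primitive idempotent is a nonzero idempotent that is not the sum of two nonzero orthogonal
idempotents. -/
def IsPrimitiveIdempotent (c : V) : Prop :=
  IsIdempotent c ∧ c ≠ 0 ∧
    ¬ ∃ a b : V, IsIdempotent a ∧ IsIdempotent b ∧ a ≠ 0 ∧ b ≠ 0 ∧ jmul a b = 0 ∧ c = a + b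

/-- The normalization of the inner product: every primitive idempotent has trace one. -/
def IsNormalized (V : Type*) [NormedAddCommGroup V] [InnerProductSpace ℝ V]
    [EuclideanJordanAlgebra V] : Prop :=
  ∀ c : V, IsPrimitiveIdempotent c → trace c = 1

/-- The quadratic map `P_x = 2 L_x L_x - L_{x ∘ x}`. -/
def quad (x : V) : V →ₗ[ℝ] V := (2 : ℝ) • (jmul x ∘ₗ jmul x) - jmul (jmul x x)

/-- `x = ∑_{l ∈ S} l c_l` is the spectral decomposition of `x`: the finitely many distinct
eigenvalues are the elements of `S`, and `(c_l)_{l ∈ S}` is a complete system of (nonzero)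
orthogonal idempotents. The values of `c` outside `S` play no role. -/
structure IsSpectralDecomposition (x : V) (S : Finset ℝ) (c : ℝ → V) : Prop where
  ne_zero : ∀ l ∈ S, c l ≠ 0
  idempotent : ∀ l ∈ S, IsIdempotent (c l)
  orthogonal : ∀ l ∈ S, ∀ k ∈ S, l ≠ k → jmul (c l) (c k) = 0
  complete : ∑ l ∈ S, c l = one
  eq_sum : x = ∑ l ∈ S, l • c l

open Classical in
/-- The functional calculus `f(x) = ∑ f(l) c_l` for the spectral decomposition `x = ∑ l c_l`.
By the spectral theorem such a decomposition exists, is unique, and so the `else` branch is not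
reached when `V` is finite-dimensional. -/
def funCalc (f : ℝ → ℝ) (x : V) : V :=
  if h : ∃ p : Finset ℝ × (ℝ → V), IsSpectralDecomposition x p.1 p.2 then
    ∑ l ∈ h.choose.1, f l • h.choose.2 l
  else 0

theorem IsSpectralDecomposition.iterate_jmul {x : V} {S : Finset ℝ} {c : ℝ → V}
    (h : IsSpectralDecomposition x S c) (n : ℕ) :
    (jmul x ^ n) one = ∑ l ∈ S, l ^ n • c l := by
  induction n with
  | zero => simp [h.complete]
  | succ n ih =>
    rw [pow_succ', Module.End.mul_apply, ih]
    conv_lhs => rw [h.eq_sum]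
    simp only [map_sum, map_smul, LinearMap.sum_apply, LinearMap.smul_apply]
    refine Finset.sum_congr rfl fun l hl => ?_
    rw [Finset.sum_eq_single l]
    · rw [h.idempotent l hl, smul_smul, pow_succ]
    · intro k hk hkl
      rw [h.orthogonal k hk l hl hkl]
      simp
    · exact fun hl' => absurd hl hl'

theorem IsSpectralDecomposition.aeval_jmul {x : V} {S : Finset ℝ} {c : ℝ → V}
    (h : IsSpectralDecomposition x S c) (p : Polynomial ℝ) :
    (Polynomial.aeval (jmul x) p) one = ∑ l ∈ S, p.eval l • c l := by
  induction p using Polynomial.induction_on' with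
  | add p q hp hq => simp [hp, hq, add_smul, Finset.sum_add_distrib]
  | monomial n a =>
    simp [Polynomial.aeval_monomial, h.iterate_jmul, smul_smul, mul_comm]

/-- `f(x)` can be computed from any spectral decomposition of `x`. -/
theorem IsSpectralDecomposition.funCalc_eq {x : V} {S : Finset ℝ} {c : ℝ → V}
    (h : IsSpectralDecomposition x S c) (f : ℝ → ℝ) :
    funCalc f x = ∑ l ∈ S, f l • c l := by
  classical
  have hex : ∃ p : Finset ℝ × (ℝ → V), IsSpectralDecomposition x p.1 p.2 := ⟨(S, c), h⟩
  rw [funCalc, dif_pos hex]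
  have h' := hex.choose_spec
  set T := hex.choose.1
  have hp : ∀ l ∈ S ∪ T, (Lagrange.interpolate (S ∪ T) id f).eval l = f l := fun l hl =>
    Lagrange.eval_interpolate_at_node (v := id) f (fun _ _ _ _ e => e) hl
  have e₁ := h.aeval_jmul (Lagrange.interpolate (S ∪ T) id f)
  have e₂ := h'.aeval_jmul (Lagrange.interpolate (S ∪ T) id f)
  rw [Finset.sum_congr rfl fun l hl => by rw [hp l (Finset.mem_union_left _ hl)]] at e₁
  rw [Finset.sum_congr rfl fun l hl => by rw [hp l (Finset.mem_union_right _ hl)]] at e₂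
  exact e₂.symm.trans e₁

/-- The real power `x ^ p` of an element `x` with nonnegative eigenvalues, for `p ≠ 0`. Since
`(0 : ℝ) ^ p = 0` in Mathlib for every `p ≠ 0`, the eigenvalue zero contributes nothing, that is,
negative powers are taken on the support of `x`. -/
def power (x : V) (p : ℝ) : V := funCalc (fun t => t ^ p) x

/-- The support idempotent of `x`: the sum of the spectral idempotents of `x` that belong to its
nonzero eigenvalues. -/
def support (x : V) : V := funCalc (fun t => if t = 0 then 0 else 1) x

open Classical in
/-- The sandwiched Rényi relative entropy of order `1 + s`. It is
`(1 / s) * log (tr ((P_{σ ^ (-s / (2 (1 + s)))} ρ) ^ (1 + s)))` if the support of `ρ` lies below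
that of `σ` (in particular if all eigenvalues of `σ` are positive) and `+∞` otherwise. -/
def sandwichedRenyi (s : ℝ) (ρ σ : V) : EReal :=
  if support σ - support ρ ∈ positiveCone V then
    ((1 / s * Real.log (trace (power (quad (power σ (-s / (2 * (1 + s)))) ρ) (1 + s))) : ℝ) :
      EReal)
  else ⊤

end Algebra

section Maps

variable {V W : Type*} [NormedAddCommGroup V] [InnerProductSpace ℝ V] [EuclideanJordanAlgebra V]
  [NormedAddCommGroup W] [InnerProductSpace ℝ W] [EuclideanJordanAlgebra W]

/-- The product of the composite system:
`(a₁ ⊗ b₁) ∘ (a₂ ⊗ b₂) = (a₁ ∘ a₂) ⊗ (b₁ ∘ b₂)`, extended bilinearly. -/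
def compositeMul (V W : Type*) [NormedAddCommGroup V] [InnerProductSpace ℝ V]
    [EuclideanJordanAlgebra V] [NormedAddCommGroup W] [InnerProductSpace ℝ W]
    [EuclideanJordanAlgebra W] : V ⊗[ℝ] W →ₗ[ℝ] V ⊗[ℝ] W →ₗ[ℝ] V ⊗[ℝ] W :=
  TensorProduct.map₂ jmul jmul

theorem compositeMul_tmul (a₁ a₂ : V) (b₁ b₂ : W) :
    compositeMul V W (a₁ ⊗ₜ b₁) (a₂ ⊗ₜ b₂) = jmul a₁ a₂ ⊗ₜ jmul b₁ b₂ := rfl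

/-- The positive cone of the composite system: the set of squares. -/
def compositeCone (V W : Type*) [NormedAddCommGroup V] [InnerProductSpace ℝ V]
    [EuclideanJordanAlgebra V] [NormedAddCommGroup W] [InnerProductSpace ℝ W]
    [EuclideanJordanAlgebra W] : Set (V ⊗[ℝ] W) :=
  squares (compositeMul V W)

def IsTracePreserving (κ : V →ₗ[ℝ] W) : Prop := ∀ x, trace (κ x) = trace x

/-- Complete positivity: `κ ⊗ id` maps the positive cone of `V ⊗ E` into that of `W ⊗ E` for every
finite-dimensional Euclidean Jordan algebra `E`. Every such `E` has an isomorphic copy in `Type`,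
so it is enough to let `E` range over that universe. -/
def IsCompletelyPositive (κ : V →ₗ[ℝ] W) : Prop :=
  ∀ (E : Type) [NormedAddCommGroup E] [InnerProductSpace ℝ E] [FiniteDimensional ℝ E]
    [EuclideanJordanAlgebra E],
    ∀ z ∈ compositeCone V E, TensorProduct.map κ (LinearMap.id : E →ₗ[ℝ] E) z ∈ compositeCone W E

structure IsTPCP (κ : V →ₗ[ℝ] W) : Prop where
  tracePreserving : IsTracePreserving κ
  completelyPositive : IsCompletelyPositive κ

end Maps

end EuclideanJordanAlgebra

end

/-!
The argument only uses that `κ` is positive and trace preserving; positivity is complete positivity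
with ancilla `ℝ` (`IsCompletelyPositive.map_mem`). Put `p = 1 + s` and `T = P_τ^(-1/2) κ P_σ^(1/2)`
with `τ = κ σ`. The map `T` is positive with `T u ≤ u`, hence a contraction for the order unit norm,
and since `κ` preserves the trace it is also a contraction between the trace norms weighted by `σ`
and `τ`. The sandwiched entropy of order `p` is the logarithm of the interpolating `p`-norm of
`P_σ^(-1/2) ρ`, so data processing follows from the three lines theorem, applied in
`inner_quad_le_rpow_mul_rpow` to an exponential sum which pairs `T P_σ^(-z/2) Y^(pz)` with
`P_τ^(z/2) Z(z)`.

On the boundary of the strip the maps `P_v` occur with `v = ∑ exp (i α k) c k` in the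
complexification of `V`, and two facts are needed there (`norm_sum_phase_phase_le`).
* For `d ≥ 0` the functional `x ↦ ⟨P_v d, x⟩` is dominated on the cone by a positive functional
  whose value at `u` is `tr d` (`norm_sum_phase_le`). This rests on the positivity of `P_x` for
  real `x` (`IsCompleteSystem.quad_mem`).
* For unitary `w` the element `P_v w` is again unitary, so that it is a combination, with
  coefficients of modulus one, of positive elements of sum `u`. Instead of the fundamental formula
  in the complexification, `isUnitaryPair_of_hasDerivAt` uses that along the flow `exp (2 i t L_x)`
  the quantities `a² + b² - u` and `[L_a, L_b]` of the element `a + i b` satisfy a homogeneous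
  linear differential equation.

The complexification itself is not constructed: its elements are written as pairs `a, b` or as sums
of Peirce components with complex coefficients. Zero eigenvalues of `σ` and `τ` are replaced by one
in the powers with exponent depending on `z`; as `ρ ≤ t σ` implies `κ ρ ≤ t κ σ`, this does not
affect the values at `ρ` and `κ ρ`.
-/

noncomputable section

namespace EuclideanJordanAlgebra

/-! ### Power associativity and the spectral theorem -/

section JordanIdentities

variable {V : Type*} [NormedAddCommGroup V] [InnerProductSpace ℝ V] [EuclideanJordanAlgebra V]

theorem jmul_one (x : V) : jmul x one = x := by rw [jmul_comm, one_jmul]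

/-- The Jordan identity polarized once in `x`. -/
theorem jordan_polar (x y z : V) :
    (2 : ℝ) • jmul (jmul x z) (jmul x y) + jmul (jmul x x) (jmul z y) =
      jmul z (jmul (jmul x x) y) + (2 : ℝ) • jmul x (jmul (jmul x z) y) := by
  have h1 := jordan (x + z) y
  have h2 := jordan (x - z) y
  have h3 := jordan z y
  simp only [map_add, map_sub, LinearMap.add_apply, LinearMap.sub_apply, jmul_comm z x] at h1 h2
  linear_combination (norm := module) (1 / 2 : ℝ) • h1 - (1 / 2 : ℝ) • h2 - h3

/-- The powers of `x`, here the iterates `L_x ^ n u`, operator commute with `x`. -/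
theorem commute_jmul_pow (x : V) (n : ℕ) :
    Commute (jmul ((jmul x ^ n) one)) (jmul x) := by
  have h2 : Commute (jmul (jmul x x)) (jmul x) := by
    ext y
    exact jordan x y
  have hone : jmul (one : V) = 1 := by
    ext y
    simp [one_jmul]
  -- `L_{x² ∘ y}` is a polynomial in `L_x`, `L_y`, `L_{x ∘ y}` and `L_{x²}`
  have key (y : V) : jmul (jmul (jmul x x) y) =
      (2 : ℝ) • (jmul (jmul x y) * jmul x) + jmul (jmul x x) * jmul y
        - (2 : ℝ) • (jmul x * jmul y * jmul x) := by
    ext z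
    have := jordan_polar x y z
    simp only [LinearMap.sub_apply, LinearMap.add_apply, LinearMap.smul_apply,
      Module.End.mul_apply]
    rw [jmul_comm (jmul x z) (jmul x y), jmul_comm z y, jmul_comm z _, jmul_comm (jmul x z) y]
      at this
    rw [eq_sub_iff_add_eq, this]
  have hsq (n : ℕ) : jmul (jmul x x) ((jmul x ^ n) one) = (jmul x ^ (n + 2)) one := by
    have := (h2.pow_right n).eq
    have := congrArg (fun f : Module.End ℝ V => f one) this
    simp only [Module.End.mul_apply, jmul_one] at this
    rw [this, pow_add, Module.End.mul_apply, pow_two, Module.End.mul_apply, jmul_one]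
  induction n using Nat.twoStepInduction with
  | zero => simp [hone]
  | one => simp [jmul_one]
  | more n ih1 ih2 =>
    rw [← hsq, key]
    rw [pow_succ', Module.End.mul_apply] at ih2
    exact (((ih2.mul_left (Commute.refl _)).smul_left _).add_left (h2.mul_left ih1)).sub_left
      ((((Commute.refl _).mul_left ih1).mul_left (Commute.refl _)).smul_left _)

/-- Power associativity, in the form that evaluation of polynomials at `x` is multiplicative. -/
theorem jmul_aeval (x : V) (p q : Polynomial ℝ) :
    jmul (Polynomial.aeval (jmul x) p one) (Polynomial.aeval (jmul x) q one) =
      Polynomial.aeval (jmul x) (p * q) one := by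
  have hc : Commute (jmul (Polynomial.aeval (jmul x) p one)) (jmul x) := by
    induction p using Polynomial.induction_on' with
    | add p q hp hq => simpa using hp.add_left hq
    | monomial n a =>
      simp only [Polynomial.aeval_monomial, Module.End.mul_apply, Module.algebraMap_end_apply,
        map_smul]
      exact (commute_jmul_pow x n).smul_left a
  have hc' : Commute (jmul (Polynomial.aeval (jmul x) p one)) (Polynomial.aeval (jmul x) q) := by
    induction q using Polynomial.induction_on' with
    | add p q hp hq => simpa using hp.add_right hq
    | monomial n a =>
      rw [Polynomial.aeval_monomial, ← Algebra.smul_def]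
      exact (hc.pow_right n).smul_right a
  have := congrArg (fun f : Module.End ℝ V => f one) hc'.eq
  simp only [Module.End.mul_apply, jmul_one] at this
  rw [this, mul_comm p q, map_mul, Module.End.mul_apply]

theorem inner_jmul_left (x y z : V) : inner ℝ (jmul x y) z = inner ℝ y (jmul x z) := by
  rw [jmul_comm, inner_jmul]

theorem isSymmetric_jmul (x : V) : (jmul x).IsSymmetric := inner_jmul_left x

/-- The spectral theorem. The spectral idempotents are Lagrange polynomials in `x`, with the
eigenvalues of the symmetric operator `L_x` as nodes. -/
theorem exists_spectralDecomposition [FiniteDimensional ℝ V] (x : V) :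
    ∃ (S : Finset ℝ) (c : ℝ → V), IsSpectralDecomposition x S c := by
  classical
  set T := (isSymmetric_jmul x)
  set b := T.eigenvectorBasis rfl
  set Λ : Finset ℝ := Finset.univ.image (T.eigenvalues rfl)
  have hzero (p q : Polynomial ℝ) (hpq : ∀ l ∈ Λ, p.eval l = q.eval l) :
      Polynomial.aeval (jmul x) p = Polynomial.aeval (jmul x) q := by
    refine b.toBasis.ext fun i => ?_
    have hi := T.hasEigenvector_eigenvectorBasis rfl i
    rw [OrthonormalBasis.coe_toBasis, Module.End.aeval_apply_of_hasEigenvector hi,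
      Module.End.aeval_apply_of_hasEigenvector hi]
    congr 1
    exact hpq _ (Finset.mem_image_of_mem _ (Finset.mem_univ i))
  set e : ℝ → Polynomial ℝ := fun l => Lagrange.interpolate Λ id (Pi.single l 1)
  have he (l k : ℝ) (hk : k ∈ Λ) : (e l).eval k = (Pi.single l 1 : ℝ → ℝ) k :=
    Lagrange.eval_interpolate_at_node (v := id) _ (fun _ _ _ _ h => h) hk
  set c : ℝ → V := fun l => Polynomial.aeval (jmul x) (e l) one
  have hsum (f : ℝ → ℝ) (p : Polynomial ℝ) (hp : ∀ l ∈ Λ, p.eval l = f l) :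
      ∑ l ∈ Λ with c l ≠ 0, f l • c l = Polynomial.aeval (jmul x) p one := by
    rw [Finset.sum_filter_of_ne (p := fun l => c l ≠ 0)
      fun l _ h h0 => h (by rw [h0, smul_zero])]
    have : Polynomial.aeval (jmul x) p = Polynomial.aeval (jmul x) (∑ l ∈ Λ, f l • e l) := by
      refine hzero _ _ fun k hk => ?_
      rw [hp k hk, Polynomial.eval_finsetSum, Finset.sum_eq_single k]
      · simp [he k k hk]
      · intro l _ hlk
        simp [he l k hk, hlk.symm]
      · exact fun h => absurd hk h
    rw [this]
    simp [c]
  refine ⟨Λ.filter fun l => c l ≠ 0, c, ⟨fun l hl => (Finset.mem_filter.1 hl).2, ?_, ?_, ?_, ?_⟩⟩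
  · intro l _
    change jmul (c l) (c l) = c l
    rw [jmul_aeval, hzero _ (e l)]
    intro k hk
    rw [Polynomial.eval_mul, he l k hk, Pi.single_apply]
    split_ifs <;> simp
  · intro l _ k _ hlk
    rw [jmul_aeval, hzero _ 0, map_zero, LinearMap.zero_apply]
    intro m hm
    rw [Polynomial.eval_mul, he l m hm, he k m hm, Pi.single_apply, Pi.single_apply]
    by_cases h : m = l
    · simp [h, hlk]
    · simp [h]
  · simpa using hsum (fun _ => 1) 1 (by simp)
  · have := hsum id Polynomial.X (by simp)
    simpa [jmul_one] using this.symm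

end JordanIdentities

/-! ### The positive cone -/

section Cone

variable {V : Type*} [NormedAddCommGroup V] [InnerProductSpace ℝ V] [EuclideanJordanAlgebra V]

/-- `L_c` is annihilated by `2 X ^ 3 - 3 X ^ 2 + X`, so its eigenvalues are among `0, 1/2, 1`. -/
theorem IsIdempotent.cubic {c : V} (hc : IsIdempotent c) (y : V) :
    (2 : ℝ) • jmul c (jmul c (jmul c y)) = (3 : ℝ) • jmul c (jmul c y) - jmul c y := by
  have h := jordan_polar c c y
  rw [show jmul c c = c from hc, show jmul c c = c from hc, jmul_comm y c,
    jmul_comm (jmul c y) c] at h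
  linear_combination (norm := module) -h

theorem IsIdempotent.inner_jmul_self {c : V} (hc : IsIdempotent c) (y : V) :
    inner ℝ (jmul c y) y = ‖jmul c y‖ ^ 2 + 4 * ‖jmul c y - jmul c (jmul c y)‖ ^ 2 := by
  -- `X = X² + 4 (X - X²)²` at `0, 1/2, 1`
  have h3 := hc.cubic y
  have h4 := hc.cubic (jmul c y)
  have h : jmul c y = jmul c (jmul c y) + (4 : ℝ) • (jmul c (jmul c y)
      - (2 : ℝ) • jmul c (jmul c (jmul c y)) + jmul c (jmul c (jmul c (jmul c y)))) := by
    linear_combination (norm := module) h3 - (2 : ℝ) • h4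
  have e1 : inner ℝ (jmul c (jmul c y)) y = ‖jmul c y‖ ^ 2 := by
    rw [inner_jmul_left, real_inner_self_eq_norm_sq]
  have e2 : inner ℝ (jmul c (jmul c y) - (2 : ℝ) • jmul c (jmul c (jmul c y))
      + jmul c (jmul c (jmul c (jmul c y)))) y = ‖jmul c y - jmul c (jmul c y)‖ ^ 2 := by
    rw [← real_inner_self_eq_norm_sq]
    simp only [inner_add_left, inner_sub_left, inner_smul_left, inner_sub_right, inner_jmul_left,
      RCLike.conj_to_real]
    ring
  conv_lhs => rw [h]
  rw [inner_add_left, inner_smul_left, e1, e2]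
  simp

theorem IsIdempotent.inner_jmul_self_nonneg {c : V} (hc : IsIdempotent c) (y : V) :
    0 ≤ inner ℝ (jmul c y) y := by
  rw [hc.inner_jmul_self]
  positivity

theorem IsIdempotent.jmul_eq_zero {c : V} (hc : IsIdempotent c) {y : V}
    (h : inner ℝ (jmul c y) y ≤ 0) : jmul c y = 0 := by
  rw [hc.inner_jmul_self] at h
  have : ‖jmul c y‖ ^ 2 = 0 := by
    nlinarith [sq_nonneg ‖jmul c y‖, sq_nonneg ‖jmul c y - jmul c (jmul c y)‖]
  simpa using this

theorem IsIdempotent.jmul_eq_zero_of_inner {c d : V} (hc : IsIdempotent c) (hd : IsIdempotent d)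
    (h : inner ℝ c d = 0) : jmul c d = 0 := by
  refine hc.jmul_eq_zero (le_of_eq ?_)
  rw [inner_jmul, show jmul d d = d from hd, h]

theorem IsIdempotent.inner_nonneg {c d : V} (hc : IsIdempotent c) (hd : IsIdempotent d) :
    0 ≤ inner ℝ c d := by
  have := hc.inner_jmul_self_nonneg d
  rwa [inner_jmul, show jmul d d = d from hd] at this

theorem IsIdempotent.mem_positiveCone {c : V} (hc : IsIdempotent c) : c ∈ positiveCone V :=
  ⟨c, hc.symm⟩

theorem isIdempotent_one : IsIdempotent (one : V) := one_jmul one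

theorem IsIdempotent.one_sub {c : V} (hc : IsIdempotent c) : IsIdempotent (one - c) := by
  have : jmul c c = c := hc
  simp [IsIdempotent, one_jmul, jmul_one, this]

/-- A complete system of pairwise orthogonal idempotents. Members may vanish. -/
structure IsCompleteSystem {ι : Type*} [Fintype ι] (c : ι → V) : Prop where
  idempotent : ∀ i, IsIdempotent (c i)
  orthogonal : ∀ i j, i ≠ j → jmul (c i) (c j) = 0
  sum_eq : ∑ i, c i = one

namespace IsCompleteSystem

variable {ι : Type*} [Fintype ι] {c : ι → V}

theorem jmul_sum_sum (hc : IsCompleteSystem c) (a b : ι → ℝ) :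
    jmul (∑ i, a i • c i) (∑ i, b i • c i) = ∑ i, (a i * b i) • c i := by
  classical
  simp only [map_sum, map_smul, LinearMap.sum_apply, LinearMap.smul_apply]
  refine Finset.sum_congr rfl fun i _ => ?_
  rw [Finset.sum_eq_single i]
  · rw [show jmul (c i) (c i) = c i from hc.idempotent i, smul_smul, mul_comm]
  · intro j _ hj
    rw [hc.orthogonal j i hj, smul_zero]
  · simp

theorem sum_mem_positiveCone (hc : IsCompleteSystem c) {a : ι → ℝ} (ha : ∀ i, 0 ≤ a i) :
    ∑ i, a i • c i ∈ positiveCone V :=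
  ⟨∑ i, √(a i) • c i, by
    rw [hc.jmul_sum_sum]
    exact Finset.sum_congr rfl fun i _ => by rw [Real.mul_self_sqrt (ha i)]⟩

theorem quad_sum_sum (hc : IsCompleteSystem c) (a b : ι → ℝ) :
    quad (∑ i, a i • c i) (∑ i, b i • c i) = ∑ i, (a i ^ 2 * b i) • c i := by
  simp only [quad, LinearMap.sub_apply, LinearMap.smul_apply, LinearMap.comp_apply,
    hc.jmul_sum_sum, Finset.smul_sum, smul_smul, ← Finset.sum_sub_distrib, ← sub_smul]
  exact Finset.sum_congr rfl fun i _ => by ring_nf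

theorem isIdempotent_sum (hc : IsCompleteSystem c) {a : ι → ℝ} (ha : ∀ i, a i = 0 ∨ a i = 1) :
    IsIdempotent (∑ i, a i • c i) := by
  rw [IsIdempotent, hc.jmul_sum_sum]
  refine Finset.sum_congr rfl fun i _ => ?_
  rcases ha i with h | h <;> simp [h]

end IsCompleteSystem

theorem IsSpectralDecomposition.isCompleteSystem {x : V} {S : Finset ℝ} {c : ℝ → V}
    (h : IsSpectralDecomposition x S c) : IsCompleteSystem (fun l : S => c l) where
  idempotent l := h.idempotent l l.2
  orthogonal l k hlk := h.orthogonal l l.2 k k.2 fun e => hlk (Subtype.ext e)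
  sum_eq := by rw [← h.complete]; exact Finset.sum_coe_sort S c

variable [FiniteDimensional ℝ V]

/-- The spectral theorem in indexed form, together with the resulting functional calculus. -/
theorem exists_system (x : V) : ∃ (S : Finset ℝ) (c : S → V), IsCompleteSystem c ∧
    x = ∑ l : S, (l : ℝ) • c l ∧ (∀ f : ℝ → ℝ, funCalc f x = ∑ l : S, f l • c l) ∧
    (x ∈ positiveCone V → ∀ l : S, 0 ≤ (l : ℝ)) := by
  obtain ⟨S, c, h⟩ := exists_spectralDecomposition x
  refine ⟨S, fun l => c l, h.isCompleteSystem, ?_, ?_, ?_⟩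
  · rw [Finset.sum_coe_sort S (fun l => l • c l)]
    exact h.eq_sum
  · intro f
    rw [Finset.sum_coe_sort S (fun l => f l • c l)]
    exact h.funCalc_eq f
  · rintro ⟨y, hy⟩ l
    have h1 : 0 ≤ inner ℝ x (c l) := by
      rw [hy, inner_jmul, real_inner_comm, jmul_comm]
      exact (h.idempotent l l.2).inner_jmul_self_nonneg y
    have h2 : jmul (c l) x = (l : ℝ) • c l := by
      rw [h.eq_sum, map_sum, Finset.sum_eq_single (l : ℝ)]
      · rw [map_smul, show jmul (c l) (c l) = c l from h.idempotent l l.2]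
      · intro k hk hkl
        rw [map_smul, h.orthogonal l l.2 k hk hkl.symm, smul_zero]
      · exact fun hl => absurd l.2 hl
    have h3 : inner ℝ x (c l) = l * ‖c l‖ ^ 2 := by
      rw [← real_inner_self_eq_norm_sq, ← real_inner_smul_left, ← h2, inner_jmul_left,
        show jmul (c l) (c l) = c l from h.idempotent l l.2]
    have h4 : 0 < ‖c l‖ ^ 2 := by
      have := norm_pos_iff.2 (h.ne_zero l l.2)
      positivity
    exact nonneg_of_mul_nonneg_left (h3 ▸ h1) h4

theorem inner_nonneg_of_mem {x y : V} (hx : x ∈ positiveCone V) (hy : y ∈ positiveCone V) :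
    0 ≤ inner ℝ x y := by
  obtain ⟨S, c, hc, rfl, -, hS⟩ := exists_system x
  obtain ⟨T, d, hd, rfl, -, hT⟩ := exists_system y
  simp only [sum_inner, inner_sum, inner_smul_left, inner_smul_right, RCLike.conj_to_real]
  exact Finset.sum_nonneg fun j _ => mul_nonneg (hT hy j) <| Finset.sum_nonneg fun i _ =>
    mul_nonneg (hS hx i) ((hc.idempotent i).inner_nonneg (hd.idempotent j))

/-- The positive cone is self-dual. -/
theorem mem_positiveCone_iff {x : V} :
    x ∈ positiveCone V ↔ ∀ d ∈ positiveCone V, 0 ≤ inner ℝ x d := by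
  refine ⟨fun hx d hd => inner_nonneg_of_mem hx hd, fun h => ?_⟩
  obtain ⟨S, c, hc, hx, -, -⟩ := exists_system x
  have key (l : S) : c l = 0 ∨ 0 ≤ (l : ℝ) := by
    rcases eq_or_ne (c l) 0 with h0 | h0
    · exact .inl h0
    right
    have h1 := h _ (hc.idempotent l).mem_positiveCone
    have h2 : inner ℝ x (c l) = l * ‖c l‖ ^ 2 := by
      rw [hx, sum_inner, Finset.sum_eq_single l]
      · rw [real_inner_smul_left, real_inner_self_eq_norm_sq]
      · intro k _ hk
        rw [real_inner_smul_left, ← show jmul (c l) (c l) = c l from hc.idempotent l,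
          ← inner_jmul, hc.orthogonal k l hk, inner_zero_left, mul_zero]
      · simp
    have h4 : 0 < ‖c l‖ ^ 2 := by
      have := norm_pos_iff.2 h0
      positivity
    exact nonneg_of_mul_nonneg_left (h2 ▸ h1) h4
  have : x = ∑ l : S, (max (l : ℝ) 0) • c l := by
    conv_lhs => rw [hx]
    refine Finset.sum_congr rfl fun l _ => ?_
    rcases key l with h0 | h0
    · simp [h0]
    · rw [max_eq_left h0]
  rw [this]
  exact hc.sum_mem_positiveCone fun l => le_max_right _ _

theorem add_mem_positiveCone {x y : V} (hx : x ∈ positiveCone V) (hy : y ∈ positiveCone V) :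
    x + y ∈ positiveCone V := by
  rw [mem_positiveCone_iff] at *
  intro d hd
  rw [inner_add_left]
  exact add_nonneg (hx d hd) (hy d hd)

theorem isClosed_positiveCone : IsClosed (positiveCone V) := by
  have : positiveCone V = ⋂ d ∈ positiveCone V, {x | 0 ≤ inner ℝ x d} := by
    ext x
    simp only [Set.mem_iInter, Set.mem_ofPred_eq]
    exact mem_positiveCone_iff
  rw [this]
  exact isClosed_biInter fun d _ => isClosed_le continuous_const (by fun_prop)

theorem jmul_eq_zero_of_inner_eq_zero {x d : V} (hx : x ∈ positiveCone V) (hd : IsIdempotent d)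
    (h : inner ℝ x d = 0) : jmul x d = 0 := by
  obtain ⟨S, c, hc, hx', -, hS⟩ := exists_system x
  rw [hx', sum_inner] at h
  simp only [real_inner_smul_left] at h
  have h1 := (Finset.sum_eq_zero_iff_of_nonneg fun i _ =>
    mul_nonneg (hS hx i) ((hc.idempotent i).inner_nonneg hd)).1 h
  rw [hx', map_sum, LinearMap.sum_apply]
  refine Finset.sum_eq_zero fun i hi => ?_
  rw [map_smul, LinearMap.smul_apply]
  rcases mul_eq_zero.1 (h1 i hi) with h2 | h2
  · rw [h2, zero_smul]
  · rw [(hc.idempotent i).jmul_eq_zero_of_inner hd h2, smul_zero]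

/-- Jordan decomposition of an element into its positive and negative parts. -/
theorem exists_pos_sub_neg (x : V) : ∃ p ∈ positiveCone V, ∃ n ∈ positiveCone V,
    x = p - n ∧ jmul p n = 0 := by
  obtain ⟨S, c, hc, hx, -, -⟩ := exists_system x
  refine ⟨∑ l : S, max (l : ℝ) 0 • c l, hc.sum_mem_positiveCone fun l => le_max_right _ _,
    ∑ l : S, max (-(l : ℝ)) 0 • c l, hc.sum_mem_positiveCone fun l => le_max_right _ _, ?_, ?_⟩
  · rw [← Finset.sum_sub_distrib]
    conv_lhs => rw [hx]
    refine Finset.sum_congr rfl fun l _ => ?_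
    rw [← sub_smul]
    congr 1
    rcases le_total (l : ℝ) 0 with h | h
    · rw [max_eq_right h, max_eq_left (by linarith)]; ring
    · rw [max_eq_left h, max_eq_right (by linarith)]; ring
  · rw [hc.jmul_sum_sum]
    refine Finset.sum_eq_zero fun l _ => ?_
    rcases le_total (l : ℝ) 0 with h | h
    · rw [max_eq_right h]; simp
    · rw [max_eq_right (show -(l : ℝ) ≤ 0 by linarith)]; simp

/-- For `x > 0` the inverse of `L_x` maps the cone into itself: test `x ∘ z` against the negative
part of `z`. -/
theorem IsCompleteSystem.mem_of_jmul_mem {ι : Type*} [Fintype ι] {c : ι → V}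
    (hc : IsCompleteSystem c) {a : ι → ℝ} (ha : ∀ i, 0 < a i) {z : V}
    (hz : jmul (∑ i, a i • c i) z ∈ positiveCone V) : z ∈ positiveCone V := by
  obtain ⟨p, hp, n, hn, rfl, hpn⟩ := exists_pos_sub_neg z
  have h1 := inner_nonneg_of_mem hz hn
  rw [map_sub, inner_sub_left, inner_jmul, hpn, inner_zero_right, zero_sub] at h1
  simp only [map_sum, map_smul, LinearMap.sum_apply, LinearMap.smul_apply, sum_inner,
    real_inner_smul_left] at h1
  have h2 (i : ι) : 0 ≤ a i * inner ℝ (jmul (c i) n) n :=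
    mul_nonneg (ha i).le ((hc.idempotent i).inner_jmul_self_nonneg n)
  have h3 := (Finset.sum_eq_zero_iff_of_nonneg fun i _ => h2 i).1
    (le_antisymm (by linarith) (Finset.sum_nonneg fun i _ => h2 i))
  have h4 (i : ι) : jmul (c i) n = 0 := by
    refine (hc.idempotent i).jmul_eq_zero (le_of_eq ?_)
    exact (mul_eq_zero.1 (h3 i (Finset.mem_univ i))).resolve_left (ha i).ne'
  have : n = 0 := by
    rw [← one_jmul n, ← hc.sum_eq, map_sum, LinearMap.sum_apply]
    exact Finset.sum_eq_zero fun i _ => h4 i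
  rwa [this, sub_zero]

end Cone

/-! ### Peirce components and positivity of the quadratic maps -/

section Peirce

variable {V : Type*} [NormedAddCommGroup V] [InnerProductSpace ℝ V] [EuclideanJordanAlgebra V]

/-- The Peirce 1-space and the Peirce 0-space of `c` annihilate each other. -/
theorem IsIdempotent.jmul_eq_zero_of_peirce {c x y : V} (hc : IsIdempotent c)
    (hx : jmul c x = x) (hy : jmul c y = 0) : jmul x y = 0 := by
  have hcc : jmul c c = c := hc
  have h1 := jordan_polar c y x
  have h2 := jordan_polar c x y
  rw [hcc, hx, hy] at h1 h2
  rw [jmul_comm y x] at h2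
  simp only [map_zero, LinearMap.zero_apply, smul_zero, zero_add, add_zero] at h1 h2
  have h3 : jmul c (jmul x y) = 0 := by linear_combination (norm := module) -h1
  rw [← h2, h3]

/-- Elements of the Peirce 0-space and of the Peirce 1-space of `c` operator commute with `c`. -/
theorem IsIdempotent.commute_of_jmul {c z : V} (hc : IsIdempotent c)
    (hz : jmul c z = 0 ∨ jmul c z = z) (y : V) :
    jmul c (jmul z y) = jmul z (jmul c y) := by
  have hcc : jmul c c = c := hc
  have h1 := jordan_polar c y z
  rw [hcc] at h1
  rcases hz with h | h
  · rw [h] at h1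
    simp only [map_zero, LinearMap.zero_apply, smul_zero, zero_add, add_zero] at h1
    exact h1
  · rw [h] at h1
    linear_combination (norm := module) -h1

theorem IsCompleteSystem.commute {ι : Type*} [Fintype ι] {c : ι → V}
    (hc : IsCompleteSystem c) (i j : ι) (y : V) :
    jmul (c i) (jmul (c j) y) = jmul (c j) (jmul (c i) y) := by
  rcases eq_or_ne i j with rfl | h
  · rfl
  · exact (hc.idempotent i).commute_of_jmul (.inl (hc.orthogonal i j h)) y

theorem IsCompleteSystem.sum_jmul {ι : Type*} [Fintype ι] {c : ι → V}
    (hc : IsCompleteSystem c) (y : V) : ∑ i, jmul (c i) y = y := by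
  conv_rhs => rw [← one_jmul y, ← hc.sum_eq, map_sum, LinearMap.sum_apply]

/-- The Peirce component maps of a family of orthogonal idempotents, indexed by ordered pairs: for
`i ≠ j` both `(i, j)` and `(j, i)` carry half of the projection onto the joint Peirce space. -/
def peirce {ι : Type*} [DecidableEq ι] (c : ι → V) (i j : ι) : V →ₗ[ℝ] V :=
  (2 : ℝ) • (jmul (c i) ∘ₗ jmul (c j)) - if i = j then jmul (c i) else 0

namespace IsCompleteSystem

variable {ι : Type*} [Fintype ι] [DecidableEq ι] {c : ι → V}

theorem jmul_peirce_self (hc : IsCompleteSystem c) (i k : ι) (y : V) :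
    jmul (c k) (peirce c i i y) = if k = i then peirce c i i y else 0 := by
  have h1 : jmul (c i) (peirce c i i y) = peirce c i i y := by
    have := (hc.idempotent i).cubic y
    simp only [peirce, if_true, LinearMap.sub_apply, LinearMap.smul_apply, LinearMap.comp_apply,
      map_sub, map_smul]
    linear_combination (norm := module) this
  split_ifs with h
  · rw [h, h1]
  · rw [jmul_comm]
    exact (hc.idempotent i).jmul_eq_zero_of_peirce h1 (hc.orthogonal i k (Ne.symm h))

theorem jmul_jmul_jmul (hc : IsCompleteSystem c) {i j : ι} (h : i ≠ j) (y : V) :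
    (2 : ℝ) • jmul (c i) (jmul (c i) (jmul (c j) y)) = jmul (c i) (jmul (c j) y) := by
  have := hc.jmul_peirce_self i j y
  rw [if_neg h.symm] at this
  simp only [peirce, if_true, LinearMap.sub_apply, LinearMap.smul_apply, LinearMap.comp_apply,
    map_sub, map_smul] at this
  rw [hc.commute j i, hc.commute j i] at this
  rwa [sub_eq_zero] at this

theorem jmul_peirce (hc : IsCompleteSystem c) (i j k : ι) (y : V) :
    jmul (c k) (peirce c i j y) =
      (((if k = i then 1 else 0) + (if k = j then 1 else 0)) / 2 : ℝ) • peirce c i j y := by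
  rcases eq_or_ne i j with rfl | hij
  · rw [hc.jmul_peirce_self]
    split_ifs <;> simp
  simp only [peirce, if_neg hij, sub_zero, LinearMap.smul_apply, LinearMap.comp_apply, map_smul]
  have hi := hc.jmul_jmul_jmul hij y
  have hj := hc.jmul_jmul_jmul hij.symm y
  rw [hc.commute j i] at hj
  by_cases hki : k = i
  · subst hki
    rw [hi, if_pos rfl, if_neg hij, smul_smul]
    norm_num
  by_cases hkj : k = j
  · subst hkj
    rw [hj, if_neg hki, if_pos rfl, smul_smul]
    norm_num
  rw [if_neg hki, if_neg hkj]
  -- the component lies in the Peirce 1-space of `c i + c j`, which `c k` annihilates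
  set w := jmul (c i) (jmul (c j) y)
  have he : IsIdempotent (c i + c j) := by
    have h1 : jmul (c i) (c i) = c i := hc.idempotent i
    have h2 : jmul (c j) (c j) = c j := hc.idempotent j
    simp [IsIdempotent, h1, h2, hc.orthogonal i j hij, hc.orthogonal j i hij.symm]
  have hw : jmul (c i + c j) w = w := by
    rw [map_add, LinearMap.add_apply]
    linear_combination (norm := module) (1 / 2 : ℝ) • hi + (1 / 2 : ℝ) • hj
  have : jmul w (c k) = 0 := he.jmul_eq_zero_of_peirce hw (by
    rw [map_add, LinearMap.add_apply, hc.orthogonal i k (Ne.symm hki),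
      hc.orthogonal j k (Ne.symm hkj), add_zero])
  rw [jmul_comm, this]
  simp

theorem jmul_sum_peirce (hc : IsCompleteSystem c) (a : ι → ℝ) (i j : ι) (y : V) :
    jmul (∑ k, a k • c k) (peirce c i j y) = ((a i + a j) / 2) • peirce c i j y := by
  simp only [map_sum, map_smul, LinearMap.sum_apply, LinearMap.smul_apply, hc.jmul_peirce,
    smul_smul, ← Finset.sum_smul]
  congr 1
  simp only [mul_div_assoc', mul_add, mul_ite, mul_one, mul_zero, ← Finset.sum_div,
    Finset.sum_add_distrib, Finset.sum_ite_eq', Finset.mem_univ, if_true]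

theorem quad_peirce (hc : IsCompleteSystem c) (a : ι → ℝ) (i j : ι) (y : V) :
    quad (∑ k, a k • c k) (peirce c i j y) = (a i * a j) • peirce c i j y := by
  simp only [quad, LinearMap.sub_apply, LinearMap.smul_apply, LinearMap.comp_apply,
    hc.jmul_sum_peirce, hc.jmul_sum_sum, map_smul]
  module

theorem sum_peirce (hc : IsCompleteSystem c) (y : V) : ∑ i, ∑ j, peirce c i j y = y := by
  simp only [peirce, LinearMap.sub_apply, LinearMap.smul_apply, LinearMap.comp_apply,
    Finset.sum_sub_distrib, ← Finset.smul_sum, ← map_sum, hc.sum_jmul]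
  have : ∑ i, ∑ j, (if i = j then jmul (c i) else 0) y = y := by
    rw [← hc.sum_jmul y]
    refine Finset.sum_congr rfl fun i _ => ?_
    rw [Finset.sum_eq_single i]
    · simp [hc.sum_jmul]
    · intro j _ hj
      rw [if_neg hj.symm, LinearMap.zero_apply]
    · simp
  rw [this]
  module

theorem quad_eq_sum (hc : IsCompleteSystem c) (a : ι → ℝ) (y : V) :
    quad (∑ k, a k • c k) y = ∑ i, ∑ j, (a i * a j) • peirce c i j y := by
  conv_lhs => rw [← hc.sum_peirce y]
  simp only [map_sum, hc.quad_peirce]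

theorem quad_quad (hc : IsCompleteSystem c) (a b : ι → ℝ) (y : V) :
    quad (∑ k, a k • c k) (quad (∑ k, b k • c k) y) = quad (∑ k, (a k * b k) • c k) y := by
  simp only [hc.quad_eq_sum b, hc.quad_eq_sum fun k => a k * b k, map_sum, map_smul,
    hc.quad_peirce, smul_smul]
  refine Finset.sum_congr rfl fun i _ => Finset.sum_congr rfl fun j _ => ?_
  congr 1
  ring

theorem inner_peirce (hc : IsCompleteSystem c) (i j : ι) (x y : V) :
    inner ℝ (peirce c i j x) y = inner ℝ x (peirce c i j y) := by
  simp only [peirce, LinearMap.sub_apply, LinearMap.smul_apply, LinearMap.comp_apply,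
    inner_sub_left, inner_sub_right, real_inner_smul_left, real_inner_smul_right, inner_jmul_left,
    hc.commute i j y]
  split_ifs <;> simp [inner_jmul_left]

theorem peirce_one (hc : IsCompleteSystem c) (i j : ι) :
    peirce c i j one = if i = j then c i else 0 := by
  split_ifs with h
  · subst h
    have h1 : jmul (c i) (c i) = c i := hc.idempotent i
    simp only [peirce, if_true, LinearMap.sub_apply, LinearMap.smul_apply, LinearMap.comp_apply,
      jmul_one, h1]
    module
  · simp [peirce, h, jmul_one, hc.orthogonal i j h]

end IsCompleteSystem

theorem inner_quad (x y z : V) : inner ℝ (quad x y) z = inner ℝ y (quad x z) := by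
  simp only [quad, LinearMap.sub_apply, LinearMap.smul_apply, LinearMap.comp_apply,
    inner_sub_left, inner_sub_right, real_inner_smul_left, real_inner_smul_right, inner_jmul_left]

/-- The quadratic map of a symmetry `s` (`s² = u`) maps squares to squares, being a Jordan
automorphism. -/
theorem quad_mem_of_jmul_self_eq_one {s : V} (hs : jmul s s = one) {x : V}
    (hx : x ∈ positiveCone V) : quad s x ∈ positiveCone V := by
  obtain ⟨y, rfl⟩ := hx
  have hU (z : V) : quad s z = (2 : ℝ) • jmul s (jmul s z) - z := by
    simp [quad, hs, one_jmul]
  have hcomm (z w : V) : jmul (jmul s z) (jmul s w) = jmul s (jmul (jmul s z) w) := by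
    have := jordan_polar s w z
    rw [hs, one_jmul, one_jmul] at this
    linear_combination (norm := module) (1 / 2 : ℝ) • this
  have hcube (z : V) : jmul s (jmul s (jmul s z)) = jmul s z := by
    have := hcomm z s
    rw [hs, jmul_one, jmul_comm (jmul s z) s] at this
    exact this.symm
  -- `y = p + h` with `p` fixed by `L_s²` and `h` in the kernel of `L_s`
  set p := jmul s (jmul s y) with hp
  set h := y - p with hh
  have hsh : jmul s h = 0 := by rw [hh, map_sub, hp, hcube, sub_self]
  have hy : y = p + h := by rw [hh]; abel
  have hpp : jmul s (jmul s (jmul p p)) = jmul p p := by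
    rw [← hcomm (jmul s y) p, ← hp, hp, hcube, ← hp, ← hcomm (jmul s y) (jmul s y)]
  have hph : jmul s (jmul p h) = 0 := by
    rw [← hcomm (jmul s y) h, hsh, map_zero]
  have hhh : jmul s (jmul s (jmul h h)) = jmul h h := by
    have h1 := jordan_polar h s s
    rw [jmul_comm h s, hsh, hs, jmul_one] at h1
    simp only [map_zero, LinearMap.zero_apply, smul_zero, zero_add, add_zero] at h1
    rw [jmul_comm s (jmul h h), ← h1]
  refine ⟨quad s y, ?_⟩
  have e1 : quad s y = p - h := by
    rw [hU, hy, map_add, map_add, hsh, map_zero, hp, hcube, ← hp]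
    module
  rw [e1, hU, hy]
  simp only [map_add, map_sub, LinearMap.add_apply, LinearMap.sub_apply, hpp, hhh, hph,
    jmul_comm h p, map_zero]
  module

variable [FiniteDimensional ℝ V]

namespace IsCompleteSystem

variable {ι : Type*} [Fintype ι] {c : ι → V}

/-- For `x > 0` the map `P_x` has Peirce multipliers `exp (a i + a j)`, which are limits of powers
of the multipliers of inverses of operators `L_z`, `z > 0`. -/
theorem quad_exp_mem (hc : IsCompleteSystem c) (a : ι → ℝ) {y : V} (hy : y ∈ positiveCone V) :
    quad (∑ k, Real.exp (a k) • c k) y ∈ positiveCone V := by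
  classical
  have hlim : Filter.Tendsto (fun n : ℕ => ∑ i, ∑ j,
      ((1 + -(a i + a j) / n) ^ n)⁻¹ • peirce c i j y) Filter.atTop
      (nhds (quad (∑ k, Real.exp (a k) • c k) y)) := by
    rw [hc.quad_eq_sum]
    refine tendsto_finsetSum _ fun i _ => tendsto_finsetSum _ fun j _ => ?_
    refine Filter.Tendsto.smul_const ?_ _
    have := (Real.tendsto_one_add_div_pow_exp (-(a i + a j))).inv₀ (Real.exp_pos _).ne'
    rwa [Real.exp_neg, inv_inv, Real.exp_add] at this
  refine isClosed_positiveCone.mem_of_tendsto hlim ?_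
  obtain ⟨M, hM⟩ : ∃ M : ℝ, ∀ i, 2 * a i ≤ M := by
    refine ⟨∑ i, |2 * a i|, fun i => (le_abs_self _).trans ?_⟩
    exact Finset.single_le_sum (f := fun i => |2 * a i|) (fun _ _ => abs_nonneg _)
      (Finset.mem_univ i)
  filter_upwards [Filter.eventually_gt_atTop ⌈max M 0⌉₊] with n hn
  have hn' : max M 0 < n := lt_of_le_of_lt (Nat.le_ceil _) (by exact_mod_cast hn)
  have hn0 : (0 : ℝ) < n := (le_max_right _ _).trans_lt hn'
  have hpos (i : ι) : 0 < 1 - 2 * a i / n := by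
    have : 2 * a i / n < 1 := (div_lt_one hn0).2 ((hM i).trans_lt ((le_max_left _ _).trans_lt hn'))
    linarith
  have hm (i j : ι) : 1 + -(a i + a j) / n = ((1 - 2 * a i / n) + (1 - 2 * a j / n)) / 2 := by
    ring
  have hne (i j : ι) : 1 + -(a i + a j) / n ≠ 0 := by
    have := hpos i
    have := hpos j
    rw [hm]
    positivity
  have key (m : ℕ) : ∑ i, ∑ j, ((1 + -(a i + a j) / n) ^ m)⁻¹ • peirce c i j y ∈
      positiveCone V := by
    induction m with
    | zero => simpa [hc.sum_peirce] using hy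
    | succ m ih =>
      refine hc.mem_of_jmul_mem hpos ?_
      convert ih using 1
      rw [map_sum]
      refine Finset.sum_congr rfl fun i _ => ?_
      rw [map_sum]
      refine Finset.sum_congr rfl fun j _ => ?_
      rw [map_smul, hc.jmul_sum_peirce, ← hm, smul_smul, pow_succ, mul_inv, mul_assoc,
        inv_mul_cancel₀ (hne i j), mul_one]
  exact key n

theorem quad_mem (hc : IsCompleteSystem c) (a : ι → ℝ) {y : V} (hy : y ∈ positiveCone V) :
    quad (∑ k, a k • c k) y ∈ positiveCone V := by
  classical
  have hnonneg (b : ι → ℝ) (hb : ∀ i, 0 ≤ b i) : quad (∑ k, b k • c k) y ∈ positiveCone V := by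
    have hlim : Filter.Tendsto (fun t : ℝ => quad (∑ k, (b k + t) • c k) y)
        (nhdsWithin 0 (Set.Ioi 0)) (nhds (quad (∑ k, b k • c k) y)) := by
      have : Continuous fun t : ℝ => quad (∑ k, (b k + t) • c k) y := by
        simp only [hc.quad_eq_sum]
        fun_prop
      simpa using (this.tendsto 0).mono_left nhdsWithin_le_nhds
    refine isClosed_positiveCone.mem_of_tendsto hlim ?_
    filter_upwards [self_mem_nhdsWithin] with t ht
    have ht' (k : ι) : Real.exp (Real.log (b k + t)) = b k + t :=
      Real.exp_log (add_pos_of_nonneg_of_pos (hb k) ht)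
    simpa only [ht'] using hc.quad_exp_mem (fun k => Real.log (b k + t)) hy
  have hs : jmul (∑ k, (if 0 ≤ a k then 1 else -1 : ℝ) • c k)
      (∑ k, (if 0 ≤ a k then 1 else -1 : ℝ) • c k) = one := by
    rw [hc.jmul_sum_sum, ← hc.sum_eq]
    refine Finset.sum_congr rfl fun k _ => ?_
    split_ifs <;> simp
  have := quad_mem_of_jmul_self_eq_one hs (hnonneg (fun k => |a k|) fun k => abs_nonneg _)
  rw [hc.quad_quad] at this
  convert this using 6 with k
  split_ifs with h
  · rw [abs_of_nonneg h, one_mul]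
  · rw [abs_of_neg (not_le.1 h)]; ring

end IsCompleteSystem

end Peirce

/-! ### Unitary elements of the complexification -/

section Unitary

variable {V : Type*} [NormedAddCommGroup V] [InnerProductSpace ℝ V] [EuclideanJordanAlgebra V]

/-- The pair `(a, b)` stands for the element `a + i b` of the complexification of `V`. It is called
unitary if `a` and `b` operator commute and `a² + b² = u`. -/
structure IsUnitaryPair (a b : V) : Prop where
  commute : ∀ y, jmul a (jmul b y) = jmul b (jmul a y)
  sq_add_sq : jmul a a + jmul b b = one

theorem inner_jmul_self_one (x : V) : inner ℝ (jmul x x) one = ‖x‖ ^ 2 := by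
  rw [inner_jmul, jmul_one, real_inner_self_eq_norm_sq]

/-- If `a` operator commutes with `b`, then `b` has only diagonal Peirce components with respect to
the spectral idempotents of `a`. -/
theorem peirce_eq_zero_of_commute {ι : Type*} [Fintype ι] [DecidableEq ι] {c : ι → V}
    (hc : IsCompleteSystem c) {a : ι → ℝ} {b : V}
    (h : ∀ y, jmul (∑ i, a i • c i) (jmul b y) = jmul b (jmul (∑ i, a i • c i) y))
    {i j : ι} (hij : a i ≠ a j) : peirce c i j b = 0 := by
  set x := ∑ i, a i • c i with hx
  have hne (k l : ι) (hkl : k ≠ l) :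
      inner ℝ (peirce c k l b) b = 2 * ‖peirce c k l b‖ ^ 2 := by
    have h1 : peirce c k l (peirce c k l b) = (1 / 2 : ℝ) • peirce c k l b := by
      have h2 (w : V) : peirce c k l w = (2 : ℝ) • jmul (c k) (jmul (c l) w) := by
        simp [peirce, hkl]
      rw [h2 (peirce c k l b), hc.jmul_peirce, if_neg hkl.symm, if_pos rfl, map_smul,
        hc.jmul_peirce, if_neg hkl, if_pos rfl]
      module
    rw [← real_inner_self_eq_norm_sq, hc.inner_peirce k l b (peirce c k l b), h1,
      real_inner_smul_right, hc.inner_peirce]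
    ring
  have h1 : quad x b = jmul (jmul x x) b := by
    have h2 := h x
    rw [jmul_comm b x, jmul_comm b] at h2
    rw [quad, LinearMap.sub_apply, LinearMap.smul_apply, LinearMap.comp_apply, h2]
    module
  have h2 : ∑ k, ∑ l, ((a k - a l) ^ 2 / 2) • peirce c k l b = 0 := by
    have h3 : jmul (jmul x x) b = ∑ k, ∑ l, ((a k * a k + a l * a l) / 2) • peirce c k l b := by
      conv_lhs => rw [hx, hc.jmul_sum_sum, ← hc.sum_peirce b, map_sum]
      refine Finset.sum_congr rfl fun k _ => ?_
      rw [map_sum]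
      exact Finset.sum_congr rfl fun l _ => hc.jmul_sum_peirce _ k l b
    rw [hx, hc.quad_eq_sum, ← hx, h3, ← sub_eq_zero, ← Finset.sum_sub_distrib] at h1
    rw [← neg_eq_zero, ← h1, ← Finset.sum_neg_distrib]
    refine Finset.sum_congr rfl fun k _ => ?_
    rw [← Finset.sum_neg_distrib, ← Finset.sum_sub_distrib]
    refine Finset.sum_congr rfl fun l _ => ?_
    module
  have h3 := congrArg (fun y => inner ℝ y b) h2
  simp only [sum_inner, real_inner_smul_left, inner_zero_left] at h3
  have h4 (k l : ι) : 0 ≤ (a k - a l) ^ 2 / 2 * inner ℝ (peirce c k l b) b := by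
    rcases eq_or_ne k l with rfl | hkl
    · simp
    · rw [hne k l hkl]
      positivity
  have h5 := (Finset.sum_eq_zero_iff_of_nonneg fun k _ =>
    Finset.sum_nonneg fun l _ => h4 k l).1 h3 i (Finset.mem_univ i)
  have h6 := (Finset.sum_eq_zero_iff_of_nonneg fun l _ => h4 i l).1 h5 j (Finset.mem_univ j)
  rw [hne i j fun e => hij (congrArg a e)] at h6
  have h7 : (a i - a j) ^ 2 / 2 ≠ 0 := by
    have := sub_ne_zero.2 hij
    positivity
  simpa [h7] using h6

/-- Within the Peirce 1-space of an idempotent `c`, an element `t c + i b` of modulus one is a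
combination, with coefficients of modulus one, of two positive elements of sum `c`. -/
theorem norm_apply_add_le_of_peirce {c b : V} {t : ℝ} (hc : IsIdempotent c) (hb : jmul c b = b)
    (hbb : jmul b b = (1 - t ^ 2) • c) (f : V →ₗ[ℝ] ℂ) (φ : V →ₗ[ℝ] ℝ)
    (hf : ∀ x ∈ positiveCone V, ‖f x‖ ≤ φ x) :
    ‖f (t • c) + Complex.I * f b‖ ≤ φ c := by
  have hcc : jmul c c = c := hc
  rcases le_or_gt (1 - t ^ 2) 0 with ht | ht
  · have h1 : ‖b‖ ^ 2 = (1 - t ^ 2) * ‖c‖ ^ 2 := by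
      rw [← inner_jmul_self_one b, hbb, real_inner_smul_left, ← inner_jmul_self_one c, hcc]
    have h2 : b = 0 := by
      have : ‖b‖ ^ 2 = 0 := le_antisymm
        (h1 ▸ mul_nonpos_of_nonpos_of_nonneg ht (sq_nonneg _)) (sq_nonneg _)
      simpa using this
    rw [h2, map_zero, mul_zero, add_zero]
    rw [h2, map_zero] at hbb
    rcases smul_eq_zero.1 hbb.symm with h3 | h3
    · have : |t| = 1 := by
        rw [← sq_eq_sq₀ (abs_nonneg t) zero_le_one, sq_abs]
        linarith
      rw [map_smul, norm_smul, Real.norm_eq_abs, this, one_mul]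
      exact hf c hc.mem_positiveCone
    · simp [h3]
  · set s := √(1 - t ^ 2)
    have hs : 0 < s := Real.sqrt_pos.2 ht
    have hss : s ^ 2 = 1 - t ^ 2 := Real.sq_sqrt ht.le
    set g := s⁻¹ • b with hg
    have hbg : b = s • g := by rw [hg, smul_smul, mul_inv_cancel₀ hs.ne', one_smul]
    have hcg : jmul c g = g := by rw [hg, map_smul, hb]
    have hgg : jmul g g = c := by
      rw [hg, map_smul, LinearMap.map_smul₂, hbb, ← hss, smul_smul, smul_smul]
      field_simp
      simp
    have he (r : ℝ) (hr : r ^ 2 = 1) : (1 / 2 : ℝ) • (c + r • g) ∈ positiveCone V := by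
      refine IsIdempotent.mem_positiveCone ?_
      simp only [IsIdempotent, map_add, map_smul, LinearMap.add_apply, LinearMap.smul_apply, hcc,
        hcg, jmul_comm g c, hgg]
      match_scalars <;> linarith
    have h1 := hf _ (he 1 (by norm_num))
    have h2 := hf _ (he (-1) (by norm_num))
    have hn (r : ℝ) (hr : r ^ 2 = 1) : ‖(t : ℂ) + r * s * Complex.I‖ = 1 := by
      rw [← sq_eq_sq₀ (norm_nonneg _) zero_le_one, ← Complex.normSq_eq_norm_sq]
      have : (t : ℂ) + r * s * Complex.I = ⟨t, r * s⟩ := by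
        apply Complex.ext <;> simp
      rw [this, Complex.normSq_mk]
      nlinarith
    have key : f (t • c) + Complex.I * f b =
        ((t : ℂ) + (1 : ℝ) * s * Complex.I) * f ((1 / 2 : ℝ) • (c + (1 : ℝ) • g)) +
        ((t : ℂ) + (-1 : ℝ) * s * Complex.I) * f ((1 / 2 : ℝ) • (c + (-1 : ℝ) • g)) := by
      rw [hbg]
      simp only [map_smul, map_add, Complex.real_smul]
      push_cast
      ring
    calc _ ≤ φ ((1 / 2 : ℝ) • (c + (1 : ℝ) • g)) + φ ((1 / 2 : ℝ) • (c + (-1 : ℝ) • g)) := by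
          rw [key]
          refine (norm_add_le _ _).trans (add_le_add ?_ ?_)
          · rwa [norm_mul, hn 1 (by norm_num), one_mul]
          · rwa [norm_mul, hn (-1) (by norm_num), one_mul]
      _ = φ c := by
          rw [← map_add]
          congr 1
          module

variable [FiniteDimensional ℝ V]

/-- A unitary element of the complexification is a combination, with coefficients of modulus one,
of positive elements of sum `u`; hence a functional that is dominated on the cone by `φ` is
bounded by `φ u` on it. -/
theorem IsUnitaryPair.norm_apply_le {a b : V} (h : IsUnitaryPair a b) (f : V →ₗ[ℝ] ℂ)
    (φ : V →ₗ[ℝ] ℝ) (hf : ∀ x ∈ positiveCone V, ‖f x‖ ≤ φ x) :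
    ‖f a + Complex.I * f b‖ ≤ φ one := by
  classical
  obtain ⟨S, c, hc, ha, -, -⟩ := exists_system a
  have hoff (i j : S) (hij : i ≠ j) : peirce c i j b = 0 :=
    peirce_eq_zero_of_commute hc (a := fun l : S => (l : ℝ)) (by rw [← ha]; exact h.commute)
      fun e => hij (Subtype.ext e)
  have hb : b = ∑ i, peirce c i i b := by
    conv_lhs => rw [← hc.sum_peirce b]
    refine Finset.sum_congr rfl fun i _ => ?_
    exact Finset.sum_eq_single i (fun j _ hj => hoff i j hj.symm) (by simp)
  set d : S → V := fun i => peirce c i i b with hd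
  have hcd (k i : S) : jmul (c k) (d i) = if k = i then d i else 0 := hc.jmul_peirce_self i k b
  have hdd (i j : S) (hij : i ≠ j) : jmul (d i) (d j) = 0 :=
    (hc.idempotent i).jmul_eq_zero_of_peirce (by simp [hcd]) (by simp [hcd, hij])
  have hbb : jmul b b = ∑ i, jmul (d i) (d i) := by
    rw [hb]
    simp only [map_sum, LinearMap.sum_apply]
    exact Finset.sum_congr rfl fun i _ =>
      Finset.sum_eq_single i (fun j _ hj => hdd j i hj) (by simp)
  have hsq (k : S) : jmul (d k) (d k) = (1 - (k : ℝ) ^ 2) • c k := by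
    have h1 : jmul (c k) (jmul b b) = jmul (d k) (d k) := by
      rw [hbb, map_sum, Finset.sum_eq_single k]
      · rw [(hc.idempotent k).commute_of_jmul (.inr (by simp [hcd])), hcd, if_pos rfl]
      · intro i _ hi
        rw [(hc.idempotent k).commute_of_jmul (.inl (by simp [hcd, hi.symm])), hcd,
          if_neg hi.symm, map_zero]
      · simp
    have h2 : jmul (c k) (jmul a a) = ((k : ℝ) ^ 2) • c k := by
      rw [ha, hc.jmul_sum_sum, map_sum, Finset.sum_eq_single k]
      · rw [map_smul, show jmul (c k) (c k) = c k from hc.idempotent k, sq]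
      · intro i _ hi
        rw [map_smul, hc.orthogonal k i hi.symm, smul_zero]
      · simp
    have h3 := congrArg (jmul (c k)) h.sq_add_sq
    rw [map_add, h1, h2, jmul_one] at h3
    linear_combination (norm := module) h3
  have key : f a + Complex.I * f b = ∑ k : S, (f ((k : ℝ) • c k) + Complex.I * f (d k)) := by
    rw [Finset.sum_add_distrib, ← Finset.mul_sum, ← map_sum, ← map_sum, ← ha, ← hb]
  rw [key, ← hc.sum_eq, map_sum]
  refine (norm_sum_le _ _).trans (Finset.sum_le_sum fun k _ => ?_)
  exact norm_apply_add_le_of_peirce (hc.idempotent k) (by simp [hcd]) (hsq k) f φ hf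

/-- The Jordan product as a continuous bilinear map. -/
def jmulL (V : Type*) [NormedAddCommGroup V] [InnerProductSpace ℝ V] [EuclideanJordanAlgebra V]
    [FiniteDimensional ℝ V] : V →L[ℝ] V →L[ℝ] V :=
  LinearMap.toContinuousLinearMap
    ((LinearMap.toContinuousLinearMap : (V →ₗ[ℝ] V) ≃ₗ[ℝ] (V →L[ℝ] V)).toLinearMap ∘ₗ jmul)

@[simp] theorem jmulL_apply (x y : V) : jmulL V x y = jmul x y := rfl

/-- The generator of the linear differential equation satisfied by the pair
`(a² + b² - u, [L_a, L_b])` along the flow `a' = -2 x ∘ b`, `b' = 2 x ∘ a`. -/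
def defectGenerator (x : V) : V × (V →L[ℝ] V) →ₗ[ℝ] V × (V →L[ℝ] V) where
  toFun p := ((-4 : ℝ) • p.2 x, jmulL V p.1 ∘L jmulL V x - jmulL V x ∘L jmulL V p.1)
  map_add' p q := by
    ext <;> simp <;> module
  map_smul' r p := by
    ext <;> (simp; module)

/-- The flow `exp (2 i t L_x)` preserves unitary elements of the complexification: the defect
`(a² + b² - u, [L_a, L_b])` solves a homogeneous linear differential equation. -/
theorem isUnitaryPair_of_hasDerivAt {a b : ℝ → V} {x : V}
    (ha : ∀ t, HasDerivAt a ((-2 : ℝ) • jmul x (b t)) t)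
    (hb : ∀ t, HasDerivAt b ((2 : ℝ) • jmul x (a t)) t)
    (h0 : IsUnitaryPair (a 0) (b 0)) (t : ℝ) : IsUnitaryPair (a t) (b t) := by
  set X : ℝ → V × (V →L[ℝ] V) := fun t =>
    (jmul (a t) (a t) + jmul (b t) (b t) - one,
      jmulL V (a t) ∘L jmulL V (b t) - jmulL V (b t) ∘L jmulL V (a t)) with hX
  have hder (t : ℝ) : HasDerivAt X (defectGenerator x (X t)) t := by
    have hLa : HasDerivAt (fun t => jmulL V (a t)) _ t :=
      (jmulL V).hasFDerivAt.comp_hasDerivAt t (ha t)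
    have hLb : HasDerivAt (fun t => jmulL V (b t)) _ t :=
      (jmulL V).hasFDerivAt.comp_hasDerivAt t (hb t)
    have h1 := ((hLa.clm_apply (ha t)).add (hLb.clm_apply (hb t))).sub_const one
    have h2 := (hLa.clm_comp hLb).sub (hLb.clm_comp hLa)
    refine (h1.prodMk h2).congr_deriv (Prod.ext ?_ (ContinuousLinearMap.ext fun y => ?_))
    · simp only [defectGenerator, LinearMap.coe_mk, AddHom.coe_mk, hX, jmulL_apply,
        sub_apply, ContinuousLinearMap.comp_apply, map_smul,
        smul_apply]
      rw [jmul_comm (jmul x (b t)) (a t), jmul_comm (jmul x (a t)) (b t), jmul_comm x, jmul_comm x]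
      module
    · have h3 := jordan_polar (a t) y x
      have h4 := jordan_polar (b t) y x
      simp only [defectGenerator, LinearMap.coe_mk, AddHom.coe_mk, hX, jmulL_apply,
        sub_apply, add_apply,
        ContinuousLinearMap.comp_apply, map_smul, map_add, map_sub, one_jmul, smul_apply]
      rw [jmul_comm x (a t), jmul_comm x (b t)]
      linear_combination (norm := module) -h3 - h4
  have hzero : X = fun _ => 0 := by
    set M := LinearMap.toContinuousLinearMap (defectGenerator x)
    refine ODE_solution_unique_univ (v := fun _ => M) (s := fun _ => Set.univ) (t₀ := 0)
      (fun _ => M.lipschitz.lipschitzOnWith) (fun t => ⟨hder t, trivial⟩)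
      (fun t => ⟨?_, trivial⟩) ?_
    · simpa using hasDerivAt_const t (0 : V × (V →L[ℝ] V))
    · refine Prod.ext ?_ (ContinuousLinearMap.ext fun y => ?_)
      · simp [hX, h0.sq_add_sq]
      · simp [hX, h0.commute]
  have ht : X t = 0 := congrFun hzero t
  refine ⟨fun y => ?_, ?_⟩
  · have := congrArg (fun p => p.2 y) ht
    simpa [hX, sub_eq_zero] using this
  · have := congrArg (fun p => p.1) ht
    simpa [hX, sub_eq_zero] using this

/-- `P_v w` is unitary for `v = ∑ exp (i α k) c k` and `w = ∑ exp (i β r) e r`. -/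
theorem isUnitaryPair_phase {ι κ : Type*} [Fintype ι] [DecidableEq ι] [Fintype κ] {c : ι → V}
    {e : κ → V} (hc : IsCompleteSystem c) (he : IsCompleteSystem e) (α : ι → ℝ) (β : κ → ℝ) :
    IsUnitaryPair (∑ r, ∑ i, ∑ j, Real.cos (β r + (α i + α j)) • peirce c i j (e r))
      (∑ r, ∑ i, ∑ j, Real.sin (β r + (α i + α j)) • peirce c i j (e r)) := by
  set a : ℝ → V := fun t =>
    ∑ r, ∑ i, ∑ j, Real.cos (β r + t * (α i + α j)) • peirce c i j (e r) with ha
  set b : ℝ → V := fun t =>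
    ∑ r, ∑ i, ∑ j, Real.sin (β r + t * (α i + α j)) • peirce c i j (e r) with hb
  have hlin (r : κ) (i j : ι) (t : ℝ) :
      HasDerivAt (fun t => β r + t * (α i + α j)) (α i + α j) t := by
    simpa using ((hasDerivAt_id t).mul_const (α i + α j)).const_add (β r)
  have h := isUnitaryPair_of_hasDerivAt (a := a) (b := b) (x := ∑ k, α k • c k)
    (fun t => ?_) (fun t => ?_) ?_ 1
  · simpa [ha, hb] using h
  · have hd : HasDerivAt a (∑ r, ∑ i, ∑ j,
        (-Real.sin (β r + t * (α i + α j)) * (α i + α j)) • peirce c i j (e r)) t :=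
      HasDerivAt.fun_sum fun r _ => HasDerivAt.fun_sum fun i _ => HasDerivAt.fun_sum fun j _ =>
        ((hlin r i j t).cos).smul_const _
    refine hd.congr_deriv ?_
    simp only [hb]
    rw [map_sum, Finset.smul_sum]
    refine Finset.sum_congr rfl fun r _ => ?_
    rw [map_sum, Finset.smul_sum]
    refine Finset.sum_congr rfl fun i _ => ?_
    rw [map_sum, Finset.smul_sum]
    refine Finset.sum_congr rfl fun j _ => ?_
    rw [map_smul, hc.jmul_sum_peirce]
    module
  · have hd : HasDerivAt b (∑ r, ∑ i, ∑ j,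
        (Real.cos (β r + t * (α i + α j)) * (α i + α j)) • peirce c i j (e r)) t :=
      HasDerivAt.fun_sum fun r _ => HasDerivAt.fun_sum fun i _ => HasDerivAt.fun_sum fun j _ =>
        ((hlin r i j t).sin).smul_const _
    refine hd.congr_deriv ?_
    simp only [ha]
    rw [map_sum, Finset.smul_sum]
    refine Finset.sum_congr rfl fun r _ => ?_
    rw [map_sum, Finset.smul_sum]
    refine Finset.sum_congr rfl fun i _ => ?_
    rw [map_sum, Finset.smul_sum]
    refine Finset.sum_congr rfl fun j _ => ?_
    rw [map_smul, hc.jmul_sum_peirce]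
    module
  · have ha0 : a 0 = ∑ r, Real.cos (β r) • e r := by
      simp only [ha, zero_mul, add_zero, ← Finset.smul_sum, hc.sum_peirce]
    have hb0 : b 0 = ∑ r, Real.sin (β r) • e r := by
      simp only [hb, zero_mul, add_zero, ← Finset.smul_sum, hc.sum_peirce]
    rw [ha0, hb0]
    refine ⟨fun y => ?_, ?_⟩
    · simp only [map_sum, map_smul, LinearMap.sum_apply, LinearMap.smul_apply, Finset.smul_sum]
      rw [Finset.sum_comm]
      refine Finset.sum_congr rfl fun r _ => Finset.sum_congr rfl fun q _ => ?_
      rw [he.commute, smul_comm]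
    · rw [he.jmul_sum_sum, he.jmul_sum_sum, ← Finset.sum_add_distrib, ← he.sum_eq]
      refine Finset.sum_congr rfl fun r _ => ?_
      rw [← add_smul, ← sq, ← sq, Real.cos_sq_add_sin_sq, one_smul]

end Unitary

/-! ### Interpolation -/

section Interpolation

variable {V : Type*} [NormedAddCommGroup V] [InnerProductSpace ℝ V] [EuclideanJordanAlgebra V]
  [FiniteDimensional ℝ V]

/-- The complex quadratic map `P_v`, `v = ∑ exp (i α k) c k = p + i q`, is dominated on the cone by
the positive map `P_p + P_q`, whose Peirce multipliers are `cos (α i - α j)`: after a rotation of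
`v` the real part of `P_v` is `P_p - P_q`. -/
theorem norm_sum_phase_le {ι : Type*} [Fintype ι] [DecidableEq ι] {c : ι → V}
    (hc : IsCompleteSystem c) (α : ι → ℝ) {d x : V} (hd : d ∈ positiveCone V)
    (hx : x ∈ positiveCone V) :
    ‖∑ k : ι × ι, Complex.exp ((α k.1 + α k.2 : ℝ) * Complex.I) *
        (inner ℝ (peirce c k.1 k.2 d) x : ℝ)‖ ≤
      ∑ k : ι × ι, Real.cos (α k.1 - α k.2) * inner ℝ (peirce c k.1 k.2 d) x := by
  set z := ∑ k : ι × ι, Complex.exp ((α k.1 + α k.2 : ℝ) * Complex.I) *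
        (inner ℝ (peirce c k.1 k.2 d) x : ℝ) with hz
  set θ := z.arg
  have h1 : (‖z‖ : ℂ) = ∑ k : ι × ι, Complex.exp ((α k.1 + α k.2 - θ : ℝ) * Complex.I) *
        (inner ℝ (peirce c k.1 k.2 d) x : ℝ) := by
    have h2 : (‖z‖ : ℂ) = Complex.exp (-(θ * Complex.I)) * z := by
      conv_rhs => rw [← Complex.norm_mul_exp_arg_mul_I z, mul_left_comm, ← Complex.exp_add]
      simp [θ]
    rw [h2, hz, Finset.mul_sum]
    refine Finset.sum_congr rfl fun k _ => ?_
    rw [← mul_assoc, ← Complex.exp_add]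
    congr 2
    push_cast
    ring
  have h3 : ‖z‖ = ∑ k : ι × ι, Real.cos (α k.1 + α k.2 - θ) *
      inner ℝ (peirce c k.1 k.2 d) x := by
    have := congrArg Complex.re h1
    simpa only [Complex.ofReal_re, Complex.re_sum, Complex.re_mul_ofReal,
      Complex.exp_ofReal_mul_I_re] using this
  have h4 : 0 ≤ inner ℝ (quad (∑ k, Real.sin (α k - θ / 2) • c k) d) x :=
    inner_nonneg_of_mem (hc.quad_mem _ hd) hx
  rw [hc.quad_eq_sum, ← Fintype.sum_prod_type', sum_inner] at h4
  simp only [real_inner_smul_left] at h4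
  rw [h3, ← sub_nonneg, ← Finset.sum_sub_distrib]
  refine (mul_nonneg zero_le_two h4).trans (le_of_eq ?_)
  rw [Finset.mul_sum]
  refine Finset.sum_congr rfl fun k _ => ?_
  have h5 : α k.1 - α k.2 = (α k.1 - θ / 2) - (α k.2 - θ / 2) := by ring
  have h6 : α k.1 + α k.2 - θ = (α k.1 - θ / 2) + (α k.2 - θ / 2) := by ring
  rw [h5, h6, Real.cos_sub, Real.cos_add]
  ring

/-- Bound on a unitary element `∑ ζ_r P_v e_r`, in which the coefficients `ζ_r` are even allowed to
lie in the closed unit disc, being means of two numbers of modulus one. -/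
theorem norm_sum_apply_le {ι κ : Type*} [Fintype ι] [DecidableEq ι] [Fintype κ] {c : ι → V}
    {e : κ → V} (hc : IsCompleteSystem c) (he : IsCompleteSystem e) (α : ι → ℝ) {ζ : κ → ℂ}
    (hζ : ∀ r, ‖ζ r‖ ≤ 1) (f : V →ₗ[ℝ] ℂ) (φ : V →ₗ[ℝ] ℝ)
    (hf : ∀ x ∈ positiveCone V, ‖f x‖ ≤ φ x) :
    ‖∑ t : κ × ι × ι, ζ t.1 * Complex.exp ((α t.2.1 + α t.2.2 : ℝ) * Complex.I) *
      f (peirce c t.2.1 t.2.2 (e t.1))‖ ≤ φ one := by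
  have key (β : κ → ℝ) : ‖∑ t : κ × ι × ι, Complex.exp (β t.1 * Complex.I) *
      Complex.exp ((α t.2.1 + α t.2.2 : ℝ) * Complex.I) *
      f (peirce c t.2.1 t.2.2 (e t.1))‖ ≤ φ one := by
    refine (le_of_eq ?_).trans ((isUnitaryPair_phase hc he α β).norm_apply_le f φ hf)
    simp only [map_sum, map_smul, Fintype.sum_prod_type, Finset.mul_sum,
      ← Finset.sum_add_distrib, Complex.real_smul]
    congr 1
    refine Finset.sum_congr rfl fun r _ => Finset.sum_congr rfl fun i _ =>
      Finset.sum_congr rfl fun j _ => ?_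
    rw [← Complex.exp_add, ← add_mul, ← Complex.ofReal_add, Complex.exp_mul_I,
      ← Complex.ofReal_cos, ← Complex.ofReal_sin]
    ring
  have hmean (r : κ) : ζ r = (Complex.exp (((ζ r).arg + Real.arccos ‖ζ r‖ : ℝ) * Complex.I) +
      Complex.exp (((ζ r).arg - Real.arccos ‖ζ r‖ : ℝ) * Complex.I)) / 2 := by
    have h1 : (‖ζ r‖ : ℂ) = Complex.cos (Real.arccos ‖ζ r‖) := by
      rw [← Complex.ofReal_cos, Real.cos_arccos (by linarith [norm_nonneg (ζ r)]) (hζ r)]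
    conv_lhs => rw [← Complex.norm_mul_exp_arg_mul_I (ζ r), h1, Complex.cos]
    push_cast
    rw [add_mul, sub_mul, Complex.exp_add, sub_eq_add_neg, Complex.exp_add, neg_mul]
    ring
  have hsplit : ∑ t : κ × ι × ι, ζ t.1 * Complex.exp ((α t.2.1 + α t.2.2 : ℝ) * Complex.I) *
      f (peirce c t.2.1 t.2.2 (e t.1)) =
      (1 / 2 : ℂ) * (∑ t : κ × ι × ι,
        Complex.exp (((ζ t.1).arg + Real.arccos ‖ζ t.1‖ : ℝ) * Complex.I) *
        Complex.exp ((α t.2.1 + α t.2.2 : ℝ) * Complex.I) * f (peirce c t.2.1 t.2.2 (e t.1))) +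
      (1 / 2 : ℂ) * (∑ t : κ × ι × ι,
        Complex.exp (((ζ t.1).arg - Real.arccos ‖ζ t.1‖ : ℝ) * Complex.I) *
        Complex.exp ((α t.2.1 + α t.2.2 : ℝ) * Complex.I) *
          f (peirce c t.2.1 t.2.2 (e t.1))) := by
    rw [Finset.mul_sum, Finset.mul_sum, ← Finset.sum_add_distrib]
    refine Finset.sum_congr rfl fun t _ => ?_
    conv_lhs => rw [hmean t.1]
    ring
  rw [hsplit]
  refine (norm_add_le _ _).trans ?_
  rw [norm_mul, norm_mul]
  have h1 := key fun r => (ζ r).arg + Real.arccos ‖ζ r‖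
  have h2 := key fun r => (ζ r).arg - Real.arccos ‖ζ r‖
  have h3 : ‖(1 / 2 : ℂ)‖ = 1 / 2 := by simp
  rw [h3]
  linarith

/-- The bound on the boundary of the strip: for a positive map `S` with `S u ≤ u` and
`y = ∑ w_q d_q`, the pairing of `P_{v'} y` with `S (∑ ζ_r P_v e_r)` is bounded by the trace norm
of `y`. -/
theorem norm_sum_phase_phase_le {ι κ ι' κ' : Type*} [Fintype ι] [DecidableEq ι] [Fintype κ]
    [Fintype ι'] [DecidableEq ι'] [Fintype κ'] {c : ι → V} {e : κ → V} {c' : ι' → V} {e' : κ' → V}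
    (hc : IsCompleteSystem c) (he : IsCompleteSystem e) (hc' : IsCompleteSystem c')
    (he' : IsCompleteSystem e') (α : ι → ℝ) (α' : ι' → ℝ) {ζ : κ → ℂ} (hζ : ∀ r, ‖ζ r‖ ≤ 1)
    (w : κ' → ℂ) {S : V →ₗ[ℝ] V} (hS : ∀ x ∈ positiveCone V, S x ∈ positiveCone V)
    (hS1 : one - S one ∈ positiveCone V) :
    ‖∑ s : κ' × ι' × ι', ∑ t : κ × ι × ι,
      (w s.1 * Complex.exp ((α' s.2.1 + α' s.2.2 : ℝ) * Complex.I)) *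
      (ζ t.1 * Complex.exp ((α t.2.1 + α t.2.2 : ℝ) * Complex.I)) *
      (inner ℝ (peirce c' s.2.1 s.2.2 (e' s.1)) (S (peirce c t.2.1 t.2.2 (e t.1))) : ℝ)‖ ≤
    ∑ q, ‖w q‖ * trace (e' q) := by
  set f : V →ₗ[ℝ] ℂ := ∑ s : κ' × ι' × ι',
    (w s.1 * Complex.exp ((α' s.2.1 + α' s.2.2 : ℝ) * Complex.I)) •
      (Complex.ofRealCLM.toLinearMap ∘ₗ
        (innerSL ℝ (peirce c' s.2.1 s.2.2 (e' s.1))).toLinearMap) with hf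
  set φ : V →ₗ[ℝ] ℝ := ∑ s : κ' × ι' × ι', (‖w s.1‖ * Real.cos (α' s.2.1 - α' s.2.2)) •
    (innerSL ℝ (peirce c' s.2.1 s.2.2 (e' s.1))).toLinearMap with hφ
  have hdom (x : V) (hx : x ∈ positiveCone V) : ‖f x‖ ≤ φ x := by
    have e1 : f x = ∑ q, w q * ∑ k : ι' × ι', Complex.exp ((α' k.1 + α' k.2 : ℝ) * Complex.I) *
        (inner ℝ (peirce c' k.1 k.2 (e' q)) x : ℝ) := by
      rw [hf, LinearMap.sum_apply, Fintype.sum_prod_type]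
      refine Finset.sum_congr rfl fun q _ => ?_
      rw [Finset.mul_sum]
      refine Finset.sum_congr rfl fun k _ => ?_
      rw [← mul_assoc]
      rfl
    have e2 : φ x = ∑ q, ‖w q‖ * ∑ k : ι' × ι', Real.cos (α' k.1 - α' k.2) *
        inner ℝ (peirce c' k.1 k.2 (e' q)) x := by
      rw [hφ, LinearMap.sum_apply, Fintype.sum_prod_type]
      refine Finset.sum_congr rfl fun q _ => ?_
      rw [Finset.mul_sum]
      refine Finset.sum_congr rfl fun k _ => ?_
      rw [← mul_assoc]
      rfl
    rw [e1, e2]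
    refine (norm_sum_le _ _).trans (Finset.sum_le_sum fun q _ => ?_)
    rw [norm_mul]
    exact mul_le_mul_of_nonneg_left
      (norm_sum_phase_le hc' α' (he'.idempotent q).mem_positiveCone hx) (norm_nonneg _)
  have hone : φ one = ∑ q, ‖w q‖ * trace (e' q) := by
    rw [hφ, LinearMap.sum_apply, Fintype.sum_prod_type]
    refine Finset.sum_congr rfl fun q _ => ?_
    rw [Fintype.sum_prod_type]
    have (k l : ι') : ((‖w q‖ * Real.cos (α' k - α' l)) •
        (innerSL ℝ (peirce c' k l (e' q))).toLinearMap) (one : V) =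
        if k = l then ‖w q‖ * inner ℝ (e' q) (c' k) else 0 := by
      change (‖w q‖ * Real.cos (α' k - α' l)) * inner ℝ (peirce c' k l (e' q)) one = _
      rw [hc'.inner_peirce, hc'.peirce_one]
      split_ifs with h
      · rw [h, sub_self, Real.cos_zero, mul_one]
      · rw [inner_zero_right, mul_zero]
    simp only [this, Finset.sum_ite_eq, Finset.mem_univ, if_true]
    rw [← Finset.mul_sum, ← inner_sum, hc'.sum_eq, trace]
  have hle : φ (S one) ≤ φ one := by
    have := (norm_nonneg _).trans (hdom _ hS1)
    rw [map_sub] at this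
    linarith
  have h := norm_sum_apply_le hc he α hζ (f ∘ₗ S) (φ ∘ₗ S) fun x hx => hdom _ (hS x hx)
  refine (le_of_eq ?_).trans (h.trans (hle.trans hone.le))
  congr 1
  rw [Finset.sum_comm]
  refine Finset.sum_congr rfl fun t _ => ?_
  rw [LinearMap.comp_apply, hf, LinearMap.sum_apply, Finset.mul_sum]
  refine Finset.sum_congr rfl fun s _ => ?_
  change _ = ζ t.1 * Complex.exp ((α t.2.1 + α t.2.2 : ℝ) * Complex.I) *
    ((w s.1 * Complex.exp ((α' s.2.1 + α' s.2.2 : ℝ) * Complex.I)) *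
      (inner ℝ (peirce c' s.2.1 s.2.2 (e' s.1)) (S (peirce c t.2.1 t.2.2 (e t.1))) : ℝ))
  ring

/-- The three lines theorem for exponential sums. -/
theorem norm_exp_sum_le {τ : Type*} [Fintype τ] (C m n : τ → ℝ) {A B θ : ℝ}
    (hA : ∀ t : ℝ, ‖∑ k, (C k : ℂ) * Complex.exp (m k + (t * Complex.I) * n k)‖ ≤ A)
    (hB : ∀ t : ℝ, ‖∑ k, (C k : ℂ) * Complex.exp (m k + (1 + t * Complex.I) * n k)‖ ≤ B)
    (h0 : 0 ≤ θ) (h1 : θ ≤ 1) :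
    ∑ k, C k * Real.exp (m k + θ * n k) ≤ A ^ (1 - θ) * B ^ θ := by
  set F : ℂ → ℂ := fun z => ∑ k, (C k : ℂ) * Complex.exp (m k + z * n k) with hF
  have hd : Differentiable ℂ F := by
    simp only [hF]
    fun_prop
  have hbdd : BddAbove ((norm ∘ F) '' Complex.HadamardThreeLines.verticalClosedStrip 0 1) := by
    refine ⟨∑ k, |C k| * Real.exp (m k + |n k|), ?_⟩
    rintro _ ⟨z, hz, rfl⟩
    refine (norm_sum_le _ _).trans (Finset.sum_le_sum fun k _ => ?_)
    rw [norm_mul, Complex.norm_real, Real.norm_eq_abs, Complex.norm_exp]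
    refine mul_le_mul_of_nonneg_left (Real.exp_le_exp.2 ?_) (abs_nonneg _)
    rw [Complex.add_re, Complex.ofReal_re, Complex.re_mul_ofReal]
    have hz' : 0 ≤ z.re ∧ z.re ≤ 1 := hz
    have : z.re * n k ≤ z.re * |n k| := mul_le_mul_of_nonneg_left (le_abs_self _) hz'.1
    nlinarith [abs_nonneg (n k)]
  have h := Complex.HadamardThreeLines.norm_le_interp_of_mem_verticalClosedStrip₀₁' F (z := θ)
    (a := A) (b := B) (by exact ⟨by simpa using h0, by simpa using h1⟩) hd.diffContOnCl hbdd
    (fun z hz => ?_) (fun z hz => ?_)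
  · rw [Complex.ofReal_re] at h
    refine le_trans ?_ h
    have : F θ = ((∑ k, C k * Real.exp (m k + θ * n k) : ℝ) : ℂ) := by
      simp [hF]
    rw [this, Complex.norm_real]
    exact le_abs_self _
  · have : z = z.im * Complex.I := by
      apply Complex.ext
      · simpa using hz
      · simp
    rw [this]
    exact hA z.im
  · have : z = 1 + z.im * Complex.I := by
      apply Complex.ext
      · simpa using hz
      · simp
    rw [this]
    exact hB z.im

end Interpolation

/-! ### Supports, and positivity of completely positive maps -/

section Support

variable {V : Type*} [NormedAddCommGroup V] [InnerProductSpace ℝ V] [EuclideanJordanAlgebra V]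

theorem inner_eq_trace_jmul (x y : V) : inner ℝ x y = trace (jmul x y) := by
  rw [trace, inner_jmul, jmul_one]

theorem IsIdempotent.trace_nonneg {c : V} (hc : IsIdempotent c) : 0 ≤ trace c :=
  hc.inner_nonneg isIdempotent_one

theorem trace_sum_smul {ι : Type*} [Fintype ι] (a : ι → ℝ) (c : ι → V) :
    trace (∑ i, a i • c i) = ∑ i, a i * trace (c i) := by
  simp [trace, sum_inner, real_inner_smul_left]

theorem quad_one (x : V) : quad one x = x := by
  simp only [quad, LinearMap.sub_apply, LinearMap.smul_apply, LinearMap.comp_apply, one_jmul]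
  module

theorem IsIdempotent.quad_apply_one {e : V} (he : IsIdempotent e) : quad e one = e := by
  have : jmul e e = e := he
  simp only [quad, LinearMap.sub_apply, LinearMap.smul_apply, LinearMap.comp_apply, jmul_one, this]
  module

variable [FiniteDimensional ℝ V]

theorem isIdempotent_support (x : V) : IsIdempotent (support x) := by
  obtain ⟨S, c, hc, -, hf, -⟩ := exists_system x
  rw [support, hf]
  refine hc.isIdempotent_sum fun i => ?_
  by_cases h : (i : ℝ) = 0 <;> simp [h]

theorem quad_mem_positiveCone (x : V) {y : V} (hy : y ∈ positiveCone V) :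
    quad x y ∈ positiveCone V := by
  obtain ⟨S, c, hc, hx, -, -⟩ := exists_system x
  rw [hx]
  exact hc.quad_mem _ hy

/-- `ρ` lives on the Peirce 1-space of any idempotent whose complement it is orthogonal to. -/
theorem quad_eq_self_of_inner_eq_zero {ρ e : V} (hρ : ρ ∈ positiveCone V) (he : IsIdempotent e)
    (h : inner ℝ ρ (one - e) = 0) : quad e ρ = ρ := by
  have h1 := jmul_eq_zero_of_inner_eq_zero hρ he.one_sub h
  rw [map_sub, jmul_one, jmul_comm, sub_eq_zero] at h1
  have hee : jmul e e = e := he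
  simp only [quad, LinearMap.sub_apply, LinearMap.smul_apply, LinearMap.comp_apply, hee, ← h1]
  module

/-- The support condition says that `ρ` is orthogonal to the complement of the support of `σ`. -/
theorem support_sub_support_mem_iff {ρ σ : V} (hρ : ρ ∈ positiveCone V) :
    support σ - support ρ ∈ positiveCone V ↔ inner ℝ ρ (one - support σ) = 0 := by
  set e := support σ with he'
  have he : IsIdempotent e := isIdempotent_support σ
  have hee : jmul e e = e := he
  obtain ⟨S, c, hc, hx, hf, hS⟩ := exists_system ρ
  have hsupp : support ρ = ∑ l : S, (if (l : ℝ) = 0 then 0 else 1 : ℝ) • c l := hf _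
  have hterm (l : S) : 0 ≤ inner ℝ (c l) (one - e) := (hc.idempotent l).inner_nonneg he.one_sub
  constructor
  · intro h
    have h1 := inner_nonneg_of_mem h he.one_sub.mem_positiveCone
    have h2 : inner ℝ e (one - e) = 0 := by
      rw [inner_eq_trace_jmul, map_sub, jmul_one, hee, sub_self, trace, inner_zero_left]
    rw [inner_sub_left, h2, zero_sub, hsupp, sum_inner] at h1
    simp only [real_inner_smul_left] at h1
    have h3 (l : S) : 0 ≤ (if (l : ℝ) = 0 then 0 else 1 : ℝ) * inner ℝ (c l) (one - e) :=
      mul_nonneg (by split_ifs <;> norm_num) (hterm l)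
    have h4 := (Finset.sum_eq_zero_iff_of_nonneg fun l _ => h3 l).1
      (le_antisymm (by linarith) (Finset.sum_nonneg fun l _ => h3 l))
    rw [hx, sum_inner]
    refine Finset.sum_eq_zero fun l hl => ?_
    have h5 := h4 l hl
    rw [real_inner_smul_left]
    split_ifs at h5 with h6
    · rw [h6, zero_mul]
    · rw [one_mul] at h5
      rw [h5, mul_zero]
  · intro h
    rw [hx, sum_inner] at h
    simp only [real_inner_smul_left] at h
    have h4 := (Finset.sum_eq_zero_iff_of_nonneg fun l _ => mul_nonneg (hS hρ l) (hterm l)).1 h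
    have h5 : jmul (support ρ) (one - e) = 0 := by
      rw [hsupp, map_sum, LinearMap.sum_apply]
      refine Finset.sum_eq_zero fun l hl => ?_
      rw [map_smul, LinearMap.smul_apply]
      rcases mul_eq_zero.1 (h4 l hl) with h6 | h6
      · simp [h6]
      · rw [(hc.idempotent l).jmul_eq_zero_of_inner he.one_sub h6, smul_zero]
    rw [map_sub, jmul_one, sub_eq_zero] at h5
    have hr : jmul (support ρ) (support ρ) = support ρ := isIdempotent_support ρ
    refine IsIdempotent.mem_positiveCone ?_
    simp only [IsIdempotent, map_sub, LinearMap.sub_apply, hee, hr, jmul_comm e, ← h5]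
    abel

/-- The support condition implies `ρ ≤ t σ` for some `t`, a relation that positive maps preserve. -/
theorem exists_smul_sub_mem {ρ σ : V} (hρ : ρ ∈ positiveCone V) (hσ : σ ∈ positiveCone V)
    (h : inner ℝ ρ (one - support σ) = 0) : ∃ t : ℝ, t • σ - ρ ∈ positiveCone V := by
  obtain ⟨S, c, hc, hx, hf, hS⟩ := exists_system σ
  obtain ⟨R, g, hg, hy, -, hR⟩ := exists_system ρ
  set M : ℝ := ∑ k : R, (k : ℝ) with hM
  have h1 : M • one - ρ ∈ positiveCone V := by
    have : M • one - ρ = ∑ k : R, (M - k) • g k := by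
      simp only [sub_smul, Finset.sum_sub_distrib, ← Finset.smul_sum, hg.sum_eq, ← hy]
    rw [this]
    refine hg.sum_mem_positiveCone fun k => sub_nonneg.2 ?_
    exact Finset.single_le_sum (f := fun k : R => (k : ℝ)) (fun k _ => hR hρ k) (Finset.mem_univ k)
  have hM0 : 0 ≤ M := Finset.sum_nonneg fun k _ => hR hρ k
  have h2 := quad_mem_positiveCone (support σ) h1
  rw [map_sub, map_smul, (isIdempotent_support σ).quad_apply_one,
    quad_eq_self_of_inner_eq_zero hρ (isIdempotent_support σ) h] at h2
  have hsupp : support σ = ∑ l : S, (if (l : ℝ) = 0 then 0 else 1 : ℝ) • c l := hf _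
  set N : ℝ := ∑ l : S, (l : ℝ)⁻¹
  refine ⟨M * N, ?_⟩
  have h3 : (M * N) • σ - M • support σ ∈ positiveCone V := by
    have : (M * N) • σ - M • support σ =
        ∑ l : S, (M * (N * l - if (l : ℝ) = 0 then 0 else 1)) • c l := by
      rw [hsupp]
      conv_lhs => rw [hx]
      rw [Finset.smul_sum, Finset.smul_sum, ← Finset.sum_sub_distrib]
      exact Finset.sum_congr rfl fun l _ => by module
    rw [this]
    refine hc.sum_mem_positiveCone fun l => mul_nonneg hM0 (sub_nonneg.2 ?_)
    split_ifs with hl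
    · rw [hl, mul_zero]
    · have h4 : (l : ℝ)⁻¹ ≤ N := Finset.single_le_sum (f := fun l : S => (l : ℝ)⁻¹)
        (fun l _ => inv_nonneg.2 (hS hσ l)) (Finset.mem_univ l)
      calc (1 : ℝ) = (l : ℝ)⁻¹ * l := (inv_mul_cancel₀ hl).symm
        _ ≤ N * l := mul_le_mul_of_nonneg_right h4 (hS hσ l)
  have := add_mem_positiveCone h3 h2
  rwa [sub_add_sub_cancel] at this

end Support

section Maps

variable {V : Type*} [NormedAddCommGroup V] [InnerProductSpace ℝ V] [EuclideanJordanAlgebra V]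

/-- The real numbers as a Euclidean Jordan algebra. -/
@[reducible] def realAlgebra : EuclideanJordanAlgebra ℝ where
  jmul := LinearMap.mul ℝ ℝ
  one := 1
  one_jmul x := by simp
  jmul_comm x y := by simp [mul_comm]
  jordan x y := by simp; ring
  inner_jmul x y z := by simp; ring

/-- Complete positivity with the real numbers as ancilla is positivity. -/
theorem IsCompletelyPositive.map_mem {κ : V →ₗ[ℝ] V} (hκ : IsCompletelyPositive κ) {x : V}
    (hx : x ∈ positiveCone V) : κ x ∈ positiveCone V := by
  let := realAlgebra
  have h11 : jmul (1 : ℝ) 1 = 1 := mul_one 1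
  obtain ⟨y, rfl⟩ := hx
  have h1 : (jmul y y) ⊗ₜ[ℝ] (1 : ℝ) ∈ compositeCone V ℝ := by
    refine ⟨y ⊗ₜ 1, ?_⟩
    rw [compositeMul_tmul, h11]
  obtain ⟨z, hz⟩ := hκ ℝ _ h1
  have hz' : z = TensorProduct.rid ℝ V z ⊗ₜ 1 := by
    rw [← TensorProduct.rid_symm_apply, LinearEquiv.symm_apply_apply]
  rw [hz', compositeMul_tmul, TensorProduct.map_tmul] at hz
  refine ⟨TensorProduct.rid ℝ V z, ?_⟩
  have := congrArg (TensorProduct.rid ℝ V) hz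
  simpa [h11] using this

end Maps

/-! ### Data processing -/

section DataProcessing

variable {V : Type*} [NormedAddCommGroup V] [InnerProductSpace ℝ V] [EuclideanJordanAlgebra V]
  [FiniteDimensional ℝ V]

/-- The interpolation inequality. Here `exp (b i)` and `exp (b' k)` are the eigenvalues of invertible
positive elements `σ` and `τ`. That `T` is positive with `T u ≤ u` makes it a contraction for the
order unit norm; that the adjoint `R` of `P_τ^(1/2) T P_σ^(-1/2)` has the same property makes `T` a
contraction between the trace norms weighted by `σ` and `τ`. -/
theorem inner_quad_le_rpow_mul_rpow {ι κ ι' κ' : Type*} [Fintype ι] [Fintype κ] [Fintype ι']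
    [Fintype κ'] {c : ι → V} {e : κ → V} {c' : ι' → V} {e' : κ' → V}
    (hc : IsCompleteSystem c) (he : IsCompleteSystem e) (hc' : IsCompleteSystem c')
    (he' : IsCompleteSystem e') (b : ι → ℝ) (b' : ι' → ℝ) {y : κ → ℝ} {y' : κ' → ℝ}
    (hy : ∀ r, 0 ≤ y r) (hy' : ∀ q, 0 ≤ y' q) {p : ℝ} (hp : 1 < p) {T R : V →ₗ[ℝ] V}
    (hT : ∀ x ∈ positiveCone V, T x ∈ positiveCone V) (hT1 : one - T one ∈ positiveCone V)
    (hR : ∀ x ∈ positiveCone V, R x ∈ positiveCone V) (hR1 : one - R one ∈ positiveCone V)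
    (hRT : ∀ x z, inner ℝ (R x) z = inner ℝ (quad (∑ k, Real.exp (b' k / 2) • c' k) x)
      (T (quad (∑ i, Real.exp (-(b i / 2)) • c i) z))) :
    inner ℝ (quad (∑ k, Real.exp (b' k / (2 * p)) • c' k) (∑ q, y' q ^ (p - 1) • e' q))
        (T (quad (∑ i, Real.exp (-(b i / (2 * p))) • c i) (∑ r, y r • e r))) ≤
      (∑ q, y' q ^ p * trace (e' q)) ^ (1 - 1 / p) * (∑ r, y r ^ p * trace (e r)) ^ (1 / p) := by
  classical
  have hp0 : 0 < p := by linarith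
  -- the exponentials cannot represent the eigenvalue zero, which is removed by an indicator
  set δ : ℝ → ℝ := fun x => if x = 0 then 0 else 1 with hδ
  have hδexp (x : ℝ) (hx : 0 ≤ x) {r : ℝ} (hr : r ≠ 0) :
      δ x * Real.exp (r * Real.log x) = x ^ r := by
    simp only [hδ]
    split_ifs with h
    · rw [h, zero_mul, Real.zero_rpow hr]
    · rw [one_mul, Real.rpow_def_of_pos (lt_of_le_of_ne hx (Ne.symm h)), mul_comm]
  have hδ0 (x : ℝ) : 0 ≤ δ x := by simp only [hδ]; split_ifs <;> norm_num
  have hδ1 (x : ℝ) : δ x ≤ 1 := by simp only [hδ]; split_ifs <;> norm_num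
  have hnormI (x : ℝ) : ‖Complex.exp ((x : ℂ) * Complex.I)‖ = 1 := Complex.norm_exp_ofReal_mul_I x
  set A : κ' × ι' × ι' → κ × ι × ι → ℝ := fun s t =>
    inner ℝ (peirce c' s.2.1 s.2.2 (e' s.1)) (T (peirce c t.2.1 t.2.2 (e t.1))) with hA
  set C : (κ' × ι' × ι') × (κ × ι × ι) → ℝ := fun k => δ (y' k.1.1) * δ (y k.2.1) * A k.1 k.2
  set m : (κ' × ι' × ι') × (κ × ι × ι) → ℝ := fun k => p * Real.log (y' k.1.1) with hm
  set n : (κ' × ι' × ι') × (κ × ι × ι) → ℝ := fun k =>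
    -(p * Real.log (y' k.1.1)) + p * Real.log (y k.2.1) +
      (b' k.1.2.1 / 2 + b' k.1.2.2 / 2) - (b k.2.2.1 / 2 + b k.2.2.2 / 2) with hn
  have hleft (t : ℝ) : ‖∑ k, (C k : ℂ) * Complex.exp (m k + (t * Complex.I) * n k)‖ ≤
      ∑ q, y' q ^ p * trace (e' q) := by
    set w : κ' → ℂ := fun q => (δ (y' q) * Real.exp (p * Real.log (y' q)) : ℝ) *
      Complex.exp ((-(t * (p * Real.log (y' q))) : ℝ) * Complex.I) with hw
    set ζ : κ → ℂ := fun r => (δ (y r) : ℝ) *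
      Complex.exp ((t * (p * Real.log (y r)) : ℝ) * Complex.I) with hζ
    have h := norm_sum_phase_phase_le hc he hc' he' (fun i => -(t * (b i / 2)))
      (fun k => t * (b' k / 2)) (ζ := ζ) (fun r => ?_) w hT hT1
    · have hw' (q : κ') : ‖w q‖ = y' q ^ p := by
        rw [hw, norm_mul, hnormI, mul_one, Complex.norm_real, hδexp _ (hy' q) hp0.ne',
          Real.norm_of_nonneg (Real.rpow_nonneg (hy' q) _)]
      simp only [hw'] at h
      refine (le_of_eq ?_).trans h
      rw [Fintype.sum_prod_type]
      congr 1
      refine Finset.sum_congr rfl fun u _ => Finset.sum_congr rfl fun v _ => ?_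
      have hexp : Complex.exp (m (u, v) + (t * Complex.I) * n (u, v)) =
          Complex.exp ((p * Real.log (y' u.1) : ℝ)) *
          Complex.exp ((-(t * (p * Real.log (y' u.1))) : ℝ) * Complex.I) *
          Complex.exp ((t * (b' u.2.1 / 2) + t * (b' u.2.2 / 2) : ℝ) * Complex.I) *
          Complex.exp ((t * (p * Real.log (y v.1)) : ℝ) * Complex.I) *
          Complex.exp ((-(t * (b v.2.1 / 2)) + -(t * (b v.2.2 / 2)) : ℝ) * Complex.I) := by
        simp only [← Complex.exp_add, hm, hn]
        congr 1
        push_cast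
        ring
      rw [hexp]
      simp only [hw, hζ, C, hA]
      push_cast
      ring
    · rw [hζ, norm_mul, hnormI, mul_one, Complex.norm_real, Real.norm_of_nonneg (hδ0 _)]
      exact hδ1 _
  have hright (t : ℝ) : ‖∑ k, (C k : ℂ) * Complex.exp (m k + (1 + t * Complex.I) * n k)‖ ≤
      ∑ r, y r ^ p * trace (e r) := by
    set w : κ → ℂ := fun r => (δ (y r) * Real.exp (p * Real.log (y r)) : ℝ) *
      Complex.exp ((t * (p * Real.log (y r)) : ℝ) * Complex.I) with hw
    set ζ : κ' → ℂ := fun q => (δ (y' q) : ℝ) *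
      Complex.exp ((-(t * (p * Real.log (y' q))) : ℝ) * Complex.I) with hζ
    have h := norm_sum_phase_phase_le hc' he' hc he (fun k => t * (b' k / 2))
      (fun i => -(t * (b i / 2))) (ζ := ζ) (fun r => ?_) w hR hR1
    · have hw' (r : κ) : ‖w r‖ = y r ^ p := by
        rw [hw, norm_mul, hnormI, mul_one, Complex.norm_real, hδexp _ (hy r) hp0.ne',
          Real.norm_of_nonneg (Real.rpow_nonneg (hy r) _)]
      simp only [hw'] at h
      refine (le_of_eq ?_).trans h
      rw [Fintype.sum_prod_type, Finset.sum_comm]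
      congr 1
      refine Finset.sum_congr rfl fun v _ => Finset.sum_congr rfl fun u _ => ?_
      have hinner : inner ℝ (peirce c v.2.1 v.2.2 (e v.1)) (R (peirce c' u.2.1 u.2.2 (e' u.1))) =
          Real.exp (b' u.2.1 / 2 + b' u.2.2 / 2 + -(b v.2.1 / 2) + -(b v.2.2 / 2)) * A u v := by
        rw [real_inner_comm, hRT, hc'.quad_peirce, hc.quad_peirce, map_smul,
          real_inner_smul_left, real_inner_smul_right]
        simp only [Real.exp_add, hA]
        ring
      have hexp : Complex.exp (m (u, v) + (1 + t * Complex.I) * n (u, v)) =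
          Complex.exp ((p * Real.log (y v.1) : ℝ)) *
          Complex.exp ((t * (p * Real.log (y v.1)) : ℝ) * Complex.I) *
          Complex.exp ((-(t * (b v.2.1 / 2)) + -(t * (b v.2.2 / 2)) : ℝ) * Complex.I) *
          Complex.exp ((-(t * (p * Real.log (y' u.1))) : ℝ) * Complex.I) *
          Complex.exp ((t * (b' u.2.1 / 2) + t * (b' u.2.2 / 2) : ℝ) * Complex.I) *
          Complex.exp ((b' u.2.1 / 2 + b' u.2.2 / 2 + -(b v.2.1 / 2) + -(b v.2.2 / 2) : ℝ)) := by
        simp only [← Complex.exp_add, hm, hn]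
        congr 1
        push_cast
        ring
      rw [hexp, hinner]
      simp only [hw, hζ, C]
      push_cast
      ring
    · rw [hζ, norm_mul, hnormI, mul_one, Complex.norm_real, Real.norm_of_nonneg (hδ0 _)]
      exact hδ1 _
  have h := norm_exp_sum_le C m n hleft hright (θ := 1 / p) (by positivity)
    ((div_le_one hp0).2 hp.le)
  refine (le_of_eq ?_).trans h
  have hZ : quad (∑ k, Real.exp (b' k / (2 * p)) • c' k) (∑ q, y' q ^ (p - 1) • e' q) =
      ∑ s : κ' × ι' × ι', (y' s.1 ^ (p - 1) * (Real.exp (b' s.2.1 / (2 * p)) *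
        Real.exp (b' s.2.2 / (2 * p)))) • peirce c' s.2.1 s.2.2 (e' s.1) := by
    rw [map_sum, Fintype.sum_prod_type]
    refine Finset.sum_congr rfl fun q _ => ?_
    rw [map_smul, hc'.quad_eq_sum, Fintype.sum_prod_type]
    simp only [Finset.smul_sum, smul_smul]
  have hY : quad (∑ i, Real.exp (-(b i / (2 * p))) • c i) (∑ r, y r • e r) =
      ∑ s : κ × ι × ι, (y s.1 * (Real.exp (-(b s.2.1 / (2 * p))) *
        Real.exp (-(b s.2.2 / (2 * p))))) • peirce c s.2.1 s.2.2 (e s.1) := by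
    rw [map_sum, Fintype.sum_prod_type]
    refine Finset.sum_congr rfl fun r _ => ?_
    rw [map_smul, hc.quad_eq_sum, Fintype.sum_prod_type]
    simp only [Finset.smul_sum, smul_smul]
  rw [hZ, hY, sum_inner]
  refine Eq.trans ?_ (Fintype.sum_prod_type _).symm
  refine Finset.sum_congr rfl fun u _ => ?_
  rw [map_sum, inner_sum]
  refine Finset.sum_congr rfl fun v _ => ?_
  rw [map_smul, real_inner_smul_left, real_inner_smul_right,
    ← hδexp _ (hy' u.1) (sub_ne_zero.2 hp.ne')]
  have hyv : y v.1 = δ (y v.1) * Real.exp (Real.log (y v.1)) := by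
    have := hδexp _ (hy v.1) one_ne_zero
    rwa [one_mul, Real.rpow_one, eq_comm] at this
  have hexp : Real.exp (m (u, v) + 1 / p * n (u, v)) =
      Real.exp ((p - 1) * Real.log (y' u.1)) * Real.exp (b' u.2.1 / (2 * p)) *
      Real.exp (b' u.2.2 / (2 * p)) * Real.exp (Real.log (y v.1)) *
      Real.exp (-(b v.2.1 / (2 * p))) * Real.exp (-(b v.2.2 / (2 * p))) := by
    simp only [← Real.exp_add, hm, hn]
    congr 1
    field_simp
    ring
  rw [hexp]
  conv_lhs => rw [hyv]
  simp only [C, hA]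
  ring

/-- The trace functional inside the sandwiched entropy does not increase under positive
trace-preserving maps, and is positive for the image state. -/
theorem trace_power_quad_le {κ : V →ₗ[ℝ] V}
    (hκ : ∀ x ∈ positiveCone V, κ x ∈ positiveCone V) (htr : IsTracePreserving κ) {ρ σ : V}
    (hρ : IsState ρ) (hσ : σ ∈ positiveCone V) (h : inner ℝ ρ (one - support σ) = 0)
    (h' : inner ℝ (κ ρ) (one - support (κ σ)) = 0) {s : ℝ} (hs : 0 < s) :
    0 < trace (power (quad (power (κ σ) (-s / (2 * (1 + s)))) (κ ρ)) (1 + s)) ∧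
    trace (power (quad (power (κ σ) (-s / (2 * (1 + s)))) (κ ρ)) (1 + s)) ≤
      trace (power (quad (power σ (-s / (2 * (1 + s)))) ρ) (1 + s)) := by
  set g : ℝ := -s / (2 * (1 + s)) with hg
  set p : ℝ := 1 + s with hp
  have hp0 : 0 < p := by linarith
  have hg0 : g ≠ 0 := by
    rw [hg]
    exact div_ne_zero (neg_ne_zero.2 hs.ne') (by positivity)
  set δ : ℝ → ℝ := fun x => if x = 0 then 0 else 1 with hδ
  have hδδ (x : ℝ) : δ x * δ x = δ x := by simp [hδ]
  have hδpow (x : ℝ) (hx : 0 ≤ x) {r : ℝ} (hr : r ≠ 0) :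
      x ^ r = δ x * Real.exp (r * Real.log x) := by
    simp only [hδ]
    split_ifs with h
    · rw [h, zero_mul, Real.zero_rpow hr]
    · rw [one_mul, Real.rpow_def_of_pos (lt_of_le_of_ne hx (Ne.symm h)), mul_comm]
  have hτ := hκ σ hσ
  have hκρ := hκ ρ hρ.1
  obtain ⟨S, c, hc, hσc, hfσ, hSpos⟩ := exists_system σ
  obtain ⟨S', c', hc', hτc, hfτ, hSpos'⟩ := exists_system (κ σ)
  replace hSpos := hSpos hσ
  replace hSpos' := hSpos' hτ
  have hsupp : support σ = ∑ l : S, δ l • c l := hfσ _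
  have hsupp' : support (κ σ) = ∑ l : S', δ l • c' l := hfτ _
  have hpow : power σ g = ∑ l : S, ((l : ℝ) ^ g) • c l := hfσ _
  have hpow' : power (κ σ) g = ∑ l : S', ((l : ℝ) ^ g) • c' l := hfτ _
  have hρσ : quad (∑ l : S, δ l • c l) ρ = ρ := by
    rw [← hsupp]
    exact quad_eq_self_of_inner_eq_zero hρ.1 (isIdempotent_support σ) h
  have hρτ : quad (∑ l : S', δ l • c' l) (κ ρ) = κ ρ := by
    rw [← hsupp']
    exact quad_eq_self_of_inner_eq_zero hκρ (isIdempotent_support (κ σ)) h'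
  set Y := quad (power σ g) ρ with hYdef
  set Y' := quad (power (κ σ) g) (κ ρ) with hYdef'
  obtain ⟨K, e, he, hYe, hfY, hKpos⟩ := exists_system Y
  obtain ⟨K', e', he', hYe', hfY', hKpos'⟩ := exists_system Y'
  replace hKpos := hKpos (quad_mem_positiveCone _ hρ.1)
  replace hKpos' := hKpos' (quad_mem_positiveCone _ hκρ)
  have htrY : trace (power Y p) = ∑ r : K, ((r : ℝ) ^ p) * trace (e r) := by
    rw [← trace_sum_smul]
    exact congrArg trace (hfY _)
  have htrY' : trace (power Y' p) = ∑ q : K', ((q : ℝ) ^ p) * trace (e' q) := by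
    rw [← trace_sum_smul]
    exact congrArg trace (hfY' _)
  rw [htrY, htrY']
  have hterm (q : K') : 0 ≤ ((q : ℝ) ^ p) * trace (e' q) :=
    mul_nonneg (Real.rpow_nonneg (hKpos' q) _) (he'.idempotent q).trace_nonneg
  have hpos : 0 < ∑ q : K', ((q : ℝ) ^ p) * trace (e' q) := by
    refine lt_of_le_of_ne (Finset.sum_nonneg fun q _ => hterm q) fun h0 => ?_
    have h1 := (Finset.sum_eq_zero_iff_of_nonneg fun q _ => hterm q).1 h0.symm
    have hY0 : Y' = 0 := by
      rw [hYe']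
      refine Finset.sum_eq_zero fun q hq => ?_
      rcases mul_eq_zero.1 (h1 q hq) with h2 | h2
      · rw [(Real.rpow_eq_zero (hKpos' q) hp0.ne').1 h2, zero_smul]
      · have h3 : jmul (e' q) (e' q) = e' q := he'.idempotent q
        have h4 : ‖e' q‖ ^ 2 = 0 := by
          rw [← inner_jmul_self_one, h3]
          exact h2
        have h5 : e' q = 0 := by simpa using h4
        rw [h5, smul_zero]
    have hback : κ ρ = quad (∑ l : S', ((l : ℝ) ^ (-g)) • c' l) Y' := by
      rw [hYdef', hpow', hc'.quad_quad]
      conv_lhs => rw [← hρτ]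
      congr 2
      refine Finset.sum_congr rfl fun l _ => ?_
      congr 1
      rw [hδpow _ (hSpos' l) hg0, hδpow _ (hSpos' l) (neg_ne_zero.2 hg0), mul_mul_mul_comm, hδδ,
        ← Real.exp_add]
      simp
    rw [hY0, map_zero] at hback
    have := htr ρ
    rw [hback, hρ.2, trace, inner_zero_left] at this
    exact zero_ne_one this
  refine ⟨hpos, ?_⟩
  -- zero eigenvalues of `σ` and `κ σ` are replaced by one, which `Real.log 0 = 0` achieves
  set T : V →ₗ[ℝ] V := quad (∑ l : S', Real.exp (-(Real.log l / 2)) • c' l) ∘ₗ κ ∘ₗ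
    quad (∑ l : S, (δ l * Real.exp (Real.log l / 2)) • c l) with hT
  set R : V →ₗ[ℝ] V := quad (∑ l : S, δ l • c l) ∘ₗ LinearMap.adjoint κ with hR
  have hexplog (x : ℝ) (hx : 0 ≤ x) : x = δ x * Real.exp (Real.log x) := by
    have := hδpow x hx one_ne_zero
    rwa [Real.rpow_one, one_mul] at this
  have hκone : LinearMap.adjoint κ one = one := by
    refine ext_inner_right ℝ fun x => ?_
    rw [LinearMap.adjoint_inner_left, real_inner_comm, real_inner_comm x]
    exact htr x
  have hTpos (x : V) (hx : x ∈ positiveCone V) : T x ∈ positiveCone V :=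
    quad_mem_positiveCone _ (hκ _ (quad_mem_positiveCone _ hx))
  have hRpos (x : V) (hx : x ∈ positiveCone V) : R x ∈ positiveCone V := by
    refine quad_mem_positiveCone _ (mem_positiveCone_iff.2 fun d hd => ?_)
    rw [LinearMap.adjoint_inner_left]
    exact inner_nonneg_of_mem hx (hκ d hd)
  have hone : (one : V) = ∑ l : S, (1 : ℝ) • c l := by simp only [one_smul, hc.sum_eq]
  have hone' : (one : V) = ∑ l : S', (1 : ℝ) • c' l := by simp only [one_smul, hc'.sum_eq]
  have hδ1 (x : ℝ) : 0 ≤ 1 - δ x := by simp only [hδ]; split_ifs <;> norm_num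
  have hT1 : one - T one ∈ positiveCone V := by
    have h1 : quad (∑ l : S, (δ l * Real.exp (Real.log l / 2)) • c l) one = σ := by
      rw [hone, hc.quad_sum_sum, hσc]
      refine Finset.sum_congr rfl fun l _ => ?_
      congr 1
      conv_rhs => rw [hexplog _ (hSpos l)]
      rw [mul_one, mul_pow, sq, hδδ, ← Real.exp_nat_mul]
      congr 2
      push_cast
      ring
    have h2 : T one = ∑ l : S', δ l • c' l := by
      rw [hT, LinearMap.comp_apply, LinearMap.comp_apply, h1, hτc, hc'.quad_sum_sum]
      refine Finset.sum_congr rfl fun l _ => ?_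
      congr 1
      have h3 : Real.exp (-(Real.log l / 2)) ^ 2 * Real.exp (Real.log l) = 1 := by
        rw [← Real.exp_nat_mul, ← Real.exp_add, Real.exp_eq_one_iff]
        push_cast
        ring
      calc _ = Real.exp (-(Real.log l / 2)) ^ 2 * (δ l * Real.exp (Real.log l)) := by
            rw [← hexplog _ (hSpos' l)]
        _ = δ l := by rw [mul_left_comm, h3, mul_one]
    rw [h2, hone', ← Finset.sum_sub_distrib]
    simp only [← sub_smul]
    exact hc'.sum_mem_positiveCone fun l => hδ1 l
  have hR1 : one - R one ∈ positiveCone V := by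
    have h2 : R one = ∑ l : S, (δ l) • c l := by
      rw [hR, LinearMap.comp_apply, hκone, hone, hc.quad_sum_sum]
      simp only [mul_one, sq, hδδ]
    rw [h2, hone, ← Finset.sum_sub_distrib]
    simp only [← sub_smul]
    exact hc.sum_mem_positiveCone fun l => hδ1 l
  have hRT (x z : V) : inner ℝ (R x) z =
      inner ℝ (quad (∑ l : S', Real.exp (Real.log l / 2) • c' l) x)
        (T (quad (∑ l : S, Real.exp (-(Real.log l / 2)) • c l) z)) := by
    rw [hR, hT]
    simp only [LinearMap.comp_apply]
    rw [inner_quad, inner_quad, LinearMap.adjoint_inner_left, hc.quad_quad, hc'.quad_quad]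
    simp only [mul_assoc, ← Real.exp_add, add_neg_cancel, Real.exp_zero, mul_one, ← hone',
      quad_one]
  have key := inner_quad_le_rpow_mul_rpow hc he hc' he' (fun l : S => Real.log l)
    (fun l : S' => Real.log l) hKpos hKpos' (p := p) (by linarith) hTpos hT1 hRpos hR1 hRT
  have hval : inner ℝ
      (quad (∑ l : S', Real.exp (Real.log l / (2 * p)) • c' l) (∑ q : K', (q : ℝ) ^ (p - 1) • e' q))
      (T (quad (∑ l : S, Real.exp (-(Real.log l / (2 * p))) • c l) (∑ r : K, (r : ℝ) • e r))) =
      ∑ q : K', ((q : ℝ) ^ p) * trace (e' q) := by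
    have h1 : quad (∑ l : S, (δ l * Real.exp (Real.log l / 2)) • c l)
        (quad (∑ l : S, Real.exp (-(Real.log l / (2 * p))) • c l) Y) = ρ := by
      rw [hYdef, hpow, hc.quad_quad, hc.quad_quad]
      conv_rhs => rw [← hρσ]
      congr 2
      refine Finset.sum_congr rfl fun l _ => ?_
      congr 1
      rw [hδpow _ (hSpos l) hg0, mul_assoc (δ _), ← Real.exp_add, mul_mul_mul_comm, hδδ,
        ← Real.exp_add]
      have : Real.log l / 2 + -(Real.log l / (2 * p)) + g * Real.log l = 0 := by
        rw [hg, hp]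
        field_simp
        ring
      rw [this, Real.exp_zero, mul_one]
    have h2 : quad (∑ l : S', Real.exp (Real.log l / (2 * p)) • c' l)
        (quad (∑ l : S', Real.exp (-(Real.log l / 2)) • c' l) (κ ρ)) = Y' := by
      rw [hYdef', hpow', hc'.quad_quad]
      conv_lhs => rw [← hρτ]
      rw [hc'.quad_quad]
      congr 2
      refine Finset.sum_congr rfl fun l _ => ?_
      congr 1
      rw [hδpow _ (hSpos' l) hg0, ← Real.exp_add, mul_comm]
      congr 2
      rw [hg, hp]
      field_simp
      ring
    rw [← hYe, hT, LinearMap.comp_apply, LinearMap.comp_apply, h1, inner_quad, h2, hYe',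
      inner_eq_trace_jmul, he'.jmul_sum_sum, trace_sum_smul]
    refine Finset.sum_congr rfl fun q _ => ?_
    congr 1
    rcases (hKpos' q).eq_or_lt with h0 | h0
    · rw [← h0, mul_zero, Real.zero_rpow hp0.ne']
    · rw [← Real.rpow_add_one h0.ne', sub_add_cancel]
  rw [hval] at key
  set A := ∑ r : K, ((r : ℝ) ^ p) * trace (e r)
  set B := ∑ q : K', ((q : ℝ) ^ p) * trace (e' q)
  have hA0 : 0 ≤ A := Finset.sum_nonneg fun r _ =>
    mul_nonneg (Real.rpow_nonneg (hKpos r) _) (he.idempotent r).trace_nonneg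
  -- `B ≤ B ^ (1 - 1 / p) * A ^ (1 / p)` with `B > 0`
  have h1 : B ^ (1 / p) ≤ A ^ (1 / p) := by
    have h2 : B = B ^ (1 - 1 / p) * B ^ (1 / p) := by
      rw [← Real.rpow_add hpos, sub_add_cancel, Real.rpow_one]
    have h3 : B ^ (1 - 1 / p) * B ^ (1 / p) ≤ B ^ (1 - 1 / p) * A ^ (1 / p) := h2 ▸ key
    exact le_of_mul_le_mul_left h3 (Real.rpow_pos_of_pos hpos _)
  exact (Real.rpow_le_rpow_iff hpos.le hA0 (by positivity)).1 h1

end DataProcessing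

end EuclideanJordanAlgebra

end

theorem theorem4p2 {V : Type*} [NormedAddCommGroup V] [InnerProductSpace ℝ V]
    [FiniteDimensional ℝ V] [EuclideanJordanAlgebra V]
    (hV : EuclideanJordanAlgebra.IsNormalized V)
    (κ : V →ₗ[ℝ] V) (hκ : EuclideanJordanAlgebra.IsTPCP κ)
    (ρ σ : V) (hρ : EuclideanJordanAlgebra.IsState ρ) (hσ : EuclideanJordanAlgebra.IsState σ)
    (s : ℝ) (hs : 0 < s) :
    EuclideanJordanAlgebra.sandwichedRenyi s (κ ρ) (κ σ) ≤
      EuclideanJordanAlgebra.sandwichedRenyi s ρ σ := by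
  open EuclideanJordanAlgebra in
  have hpos : ∀ x ∈ positiveCone V, κ x ∈ positiveCone V := fun x hx =>
    hκ.completelyPositive.map_mem hx
  by_cases hsupp : support σ - support ρ ∈ positiveCone V
  · have h := (support_sub_support_mem_iff hρ.1).1 hsupp
    obtain ⟨t, ht⟩ := exists_smul_sub_mem hρ.1 hσ.1 h
    have h' : inner ℝ (κ ρ) (one - support (κ σ)) = 0 := by
      -- apply `κ` to `ρ ≤ t σ`
      have hidem := isIdempotent_support (κ σ)
      have h1 := inner_nonneg_of_mem (hpos _ ht) hidem.one_sub.mem_positiveCone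
      have h2 : inner ℝ (κ σ) (one - support (κ σ)) = 0 :=
        (support_sub_support_mem_iff (hpos σ hσ.1)).1 (by
          rw [sub_self]
          exact ⟨0, by simp⟩)
      rw [map_sub, map_smul, inner_sub_left, real_inner_smul_left, h2, mul_zero, zero_sub] at h1
      exact le_antisymm (by linarith)
        (inner_nonneg_of_mem (hpos ρ hρ.1) hidem.one_sub.mem_positiveCone)
    have hsupp' := (support_sub_support_mem_iff (hpos ρ hρ.1)).2 h'
    obtain ⟨hB, hBA⟩ := trace_power_quad_le hpos hκ.tracePreserving hρ hσ.1 h h' hs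
    rw [sandwichedRenyi, sandwichedRenyi, if_pos hsupp, if_pos hsupp', EReal.coe_le_coe_iff]
    exact mul_le_mul_of_nonneg_left (Real.log_le_log hB hBA) (by positivity)
  · rw [sandwichedRenyi.eq_def s ρ σ, if_neg hsupp]
    exact le_top
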